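/- Let $n\ge 0$ and let $\mu$ be a Radon measure on $\mathbb{R}^n$ (a Borel measure, finite on bounded sets). Definitions. For a Radon measure $\mu$ on $\mathbb{R}^n$, let $\mathrm{Lip}_b(\mathbb{R}^n)$ be the algebra of bounded Lipschitz functions $f:\mathbb{R}^n\to\mathbb{R}$, with the norm $\|f\|_{\mathrm{Lip}}=\max\{L(f),\|f\|_\infty\}$, where $L(f)$ is the Lipschitz constant of $f$. A *derivation* is a bounded linear operator $\delta:\mathrm{Lip}_b(\mathbb{R}^n)\to L^\infty(\mathbb{R}^n,\mu)$ such that $\delta(fg)=f\,\delta g+g\,\delta f$ for all $f,g$, and such that $\delta f_j\to\delta f$ weak-star in $L^\infty(\mathbb{R}^n,\mu)=L^1(\mathbb{R}^n,\mu)^*$ whenever $(f_j)$ is a bounded sequence in $\mathrm{Lip}_b(\mathbb{R}^n)$ converging pointwise to $f\in\mathrm{Lip}_b(\mathbb{R}^n)$. The derivations form a module $\Upsilon(\mathbb{R}^n,\mu)$ over the ring $L^\infty(\mathbb{R}^n,\mu)$ via $(\lambda\delta)f=\lambda\cdot\delta f$; its *rank* is the supremum of the cardinalities of its linearly independent subsets.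 A *tangent measure* of $\mu$ at $a\in\mathbb{R}^n$ is a nonzero Radon measure $\nu$ on $\mathbb{R}^n$ for which there are $c_j>0$ and $r_j\searrow 0$, $r_j>0$, with $$\lim_{j\to\infty} c_j\int_{\mathbb{R}^n}\varphi\Big(\frac{x-a}{r_j}\Big)\,d\mu(x)=\int_{\mathbb{R}^n}\varphi\,d\nu\qquad\text{for all }\varphi\in C_c(\mathbb{R}^n).$$ The set of these is denoted $\mathrm{Tan}(\mu,a)$. Statement. If $\Upsilon(\mathbb{R}^n,\mu)$ has rank $n$, then for $\mu$-almost every $a\in\mathbb{R}^n$ and for every $\nu\in\mathrm{Tan}(\mu,a)$, the module $\Upsilon(\mathbb{R}^n,\nu)$ also has rank $n$. -/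

import Mathlib

open MeasureTheory Filter Topology
open scoped NNReal ENNReal CompactlySupported

noncomputable section

/-- `Lip_b(X)`: the algebra of bounded Lipschitz functions `X → ℝ`. -/
def LipB (X : Type*) [MetricSpace X] : Subalgebra ℝ (X → ℝ) where
  carrier := {f | (∃ K : ℝ≥0, LipschitzWith K f) ∧ ∃ C : ℝ, ∀ x, |f x| ≤ C}
  mul_mem' := by
    rintro f g ⟨⟨K, hK⟩, C, hC⟩ ⟨⟨L, hL⟩, D, hD⟩
    refine ⟨⟨Real.toNNReal (C * L + D * K), ?_⟩, C * D, fun x => ?_⟩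
    · refine LipschitzWith.of_dist_le' fun x y => ?_
      have h1 := hK.dist_le_mul x y
      have h2 := hL.dist_le_mul x y
      rw [Real.dist_eq] at h1 h2 ⊢
      have h3 : (f * g) x - (f * g) y = f x * (g x - g y) + (f x - f y) * g y := by
        simp only [Pi.mul_apply]; ring
      rw [h3]
      refine (abs_add_le _ _).trans ?_
      rw [abs_mul, abs_mul]
      have h4 : |f x| * |g x - g y| ≤ C * (L * dist x y) :=
        mul_le_mul (hC x) h2 (abs_nonneg _) ((abs_nonneg _).trans (hC x))
      have h5 : |f x - f y| * |g y| ≤ (K * dist x y) * D :=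
        mul_le_mul h1 (hD y) (abs_nonneg _) ((abs_nonneg _).trans h1)
      linarith
    · simp only [Pi.mul_apply, abs_mul]
      exact mul_le_mul (hC x) (hD x) (abs_nonneg _) ((abs_nonneg _).trans (hC x))
  add_mem' := by
    rintro f g ⟨⟨K, hK⟩, C, hC⟩ ⟨⟨L, hL⟩, D, hD⟩
    exact ⟨⟨K + L, hK.add hL⟩, C + D, fun x =>
      (abs_add_le _ _).trans (add_le_add (hC x) (hD x))⟩
  algebraMap_mem' := fun c => ⟨⟨0, LipschitzWith.const c⟩, |c|, fun _ => le_refl |c|⟩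

/-- `‖f‖_Lip ≤ K`, where `‖f‖_Lip = max (L(f), ‖f‖_∞)` and `L(f)` is the Lipschitz constant. -/
def LipNormLE {X : Type*} [MetricSpace X] (f : LipB X) (K : ℝ≥0) : Prop :=
  LipschitzWith K (f : X → ℝ) ∧ ∀ x, |(f : X → ℝ) x| ≤ K

/-- The ring of `μ`-a.e. classes of measurable real functions, with its existing pointwise
addition and multiplication. -/
instance instCommRingAEEqFunReal {X : Type*} [MeasurableSpace X] (μ : Measure X) :
    CommRing (X →ₘ[μ] ℝ) where
  __ := (inferInstance : AddCommGroup (X →ₘ[μ] ℝ))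
  __ := (inferInstance : CommMonoid (X →ₘ[μ] ℝ))
  left_distrib := fun u v w => AEEqFun.toGerm_injective <| by
    simp only [AEEqFun.mul_toGerm, AEEqFun.add_toGerm, mul_add]
  right_distrib := fun u v w => AEEqFun.toGerm_injective <| by
    simp only [AEEqFun.mul_toGerm, AEEqFun.add_toGerm, add_mul]
  zero_mul := fun u => AEEqFun.toGerm_injective <| by
    simp only [AEEqFun.mul_toGerm, AEEqFun.zero_toGerm, zero_mul]
  mul_zero := fun u => AEEqFun.toGerm_injective <| by
    simp only [AEEqFun.mul_toGerm, AEEqFun.zero_toGerm, mul_zero]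

instance instAlgebraAEEqFunReal {X : Type*} [MeasurableSpace X] (μ : Measure X) :
    Algebra ℝ (X →ₘ[μ] ℝ) :=
  Algebra.ofModule
    (fun c u v => AEEqFun.induction_on₂ u v fun f hf g hg => by
      simp only [AEEqFun.smul_mk, AEEqFun.mk_mul_mk, smul_mul_assoc])
    (fun c u v => AEEqFun.induction_on₂ u v fun f hf g hg => by
      simp only [AEEqFun.smul_mk, AEEqFun.mk_mul_mk, mul_smul_comm])

/-- `L^∞(X, μ)` as an algebra: the `μ`-a.e. classes of real functions that are essentially
bounded, with the pointwise operations. -/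
def Linfty {X : Type*} [MeasurableSpace X] (μ : Measure X) : Subalgebra ℝ (X →ₘ[μ] ℝ) where
  carrier := {u | ∃ C : ℝ, ∀ᵐ x ∂μ, |u x| ≤ C}
  mul_mem' := by
    rintro u v ⟨C, hC⟩ ⟨D, hD⟩
    refine ⟨C * D, ?_⟩
    filter_upwards [hC, hD, AEEqFun.coeFn_mul u v] with x h1 h2 h3
    rw [h3, Pi.mul_apply, abs_mul]
    exact mul_le_mul h1 h2 (abs_nonneg _) ((abs_nonneg _).trans h1)
  add_mem' := by
    rintro u v ⟨C, hC⟩ ⟨D, hD⟩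
    refine ⟨C + D, ?_⟩
    filter_upwards [hC, hD, AEEqFun.coeFn_add u v] with x h1 h2 h3
    rw [h3, Pi.add_apply]
    exact (abs_add_le _ _).trans (add_le_add h1 h2)
  algebraMap_mem' := fun c => by
    refine ⟨|c|, ?_⟩
    filter_upwards [AEEqFun.coeFn_smul (μ := μ) c (1 : X →ₘ[μ] ℝ),
      AEEqFun.coeFn_one (μ := μ) (β := ℝ)] with x hx h1
    rw [Algebra.algebraMap_eq_smul_one, hx, Pi.smul_apply, h1]
    simp

/-- The class in `L^∞(X, μ)` of a bounded Lipschitz function. -/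
def LipB.toLinfty {X : Type*} [MetricSpace X] [MeasurableSpace X] [BorelSpace X]
    (μ : Measure X) (f : LipB X) : Linfty μ :=
  ⟨AEEqFun.mk (f : X → ℝ) (f.2.1.choose_spec.continuous.aestronglyMeasurable), by
    obtain ⟨C, hC⟩ := f.2.2
    refine ⟨C, ?_⟩
    filter_upwards [AEEqFun.coeFn_mk (μ := μ) (f : X → ℝ)
      (f.2.1.choose_spec.continuous.aestronglyMeasurable)] with x hx
    rw [hx]
    exact hC x⟩

/-- `d : Lip_b(X) → L^∞(X, μ)`, linear, is a (metric) derivation: it is bounded, obeys the product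
rule, and maps bounded pointwise convergent sequences of `Lip_b(X)` to weak-star convergent
sequences of `L^∞(X, μ)`, the weak-star topology being the one induced by `L^1(X, μ)`. -/
structure IsMetricDerivation {X : Type*} [MetricSpace X] [MeasurableSpace X] [BorelSpace X]
    (μ : Measure X) (d : LipB X →ₗ[ℝ] Linfty μ) : Prop where
  bounded : ∃ M : ℝ, ∀ (f : LipB X) (K : ℝ≥0), LipNormLE f K →
    ∀ᵐ x ∂μ, |(d f : X →ₘ[μ] ℝ) x| ≤ M * K
  leibniz : ∀ f g : LipB X,
    d (f * g) = LipB.toLinfty μ f * d g + LipB.toLinfty μ g * d f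
  weakContinuous : ∀ (F : ℕ → LipB X) (f : LipB X),
    (∃ K : ℝ≥0, ∀ j, LipNormLE (F j) K) →
    (∀ x, Tendsto (fun j => (F j : X → ℝ) x) atTop (𝓝 ((f : X → ℝ) x))) →
    ∀ h : X → ℝ, Integrable h μ →
      Tendsto (fun j => ∫ x, h x * (d (F j) : X →ₘ[μ] ℝ) x ∂μ) atTop
        (𝓝 (∫ x, h x * (d f : X →ₘ[μ] ℝ) x ∂μ))

theorem Linfty.integrable_mul {X : Type*} [MeasurableSpace X] {μ : Measure X} (u : Linfty μ)
    {h : X → ℝ} (hh : Integrable h μ) :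
    Integrable (fun x => h x * (u : X →ₘ[μ] ℝ) x) μ := by
  obtain ⟨C, hC⟩ := u.2
  exact hh.mul_bdd (c := C) (u : X →ₘ[μ] ℝ).aestronglyMeasurable hC

/-- The module `Υ(X, μ)` of derivations, over the ring `L^∞(X, μ)`, with the action
`(u • d) f = u * d f`. -/
def DerivationModule {X : Type*} [MetricSpace X] [MeasurableSpace X] [BorelSpace X]
    (μ : Measure X) : Submodule (Linfty μ) (LipB X →ₗ[ℝ] Linfty μ) where
  carrier := {d | IsMetricDerivation μ d}
  add_mem' := by
    rintro d e hd he
    refine ⟨?_, fun f g => ?_, fun F f hF hlim h hh => ?_⟩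
    · obtain ⟨M, hM⟩ := hd.bounded
      obtain ⟨N, hN⟩ := he.bounded
      refine ⟨M + N, fun f K hf => ?_⟩
      filter_upwards [hM f K hf, hN f K hf,
        AEEqFun.coeFn_add (d f : X →ₘ[μ] ℝ) (e f : X →ₘ[μ] ℝ)] with x h1 h2 h3
      simp only [LinearMap.add_apply, Subalgebra.coe_add]
      rw [h3, Pi.add_apply, add_mul]
      exact (abs_add_le _ _).trans (add_le_add h1 h2)
    · simp only [LinearMap.add_apply, hd.leibniz, he.leibniz]
      ring
    · have key : ∀ g : LipB X, ∫ x, h x * ((d + e) g : X →ₘ[μ] ℝ) x ∂μ =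
          ∫ x, h x * (d g : X →ₘ[μ] ℝ) x ∂μ + ∫ x, h x * (e g : X →ₘ[μ] ℝ) x ∂μ := by
        intro g
        rw [← integral_add (Linfty.integrable_mul _ hh) (Linfty.integrable_mul _ hh)]
        refine integral_congr_ae ?_
        filter_upwards [AEEqFun.coeFn_add (d g : X →ₘ[μ] ℝ) (e g : X →ₘ[μ] ℝ)] with x h3
        simp only [LinearMap.add_apply, Subalgebra.coe_add]
        rw [h3, Pi.add_apply, mul_add]
      simp only [key]
      exact (hd.weakContinuous F f hF hlim h hh).add (he.weakContinuous F f hF hlim h hh)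
  zero_mem' := by
    have hz : ∀ g : LipB X,
        (fun x => (((0 : LipB X →ₗ[ℝ] Linfty μ) g : Linfty μ) : X →ₘ[μ] ℝ) x) =ᵐ[μ] 0 :=
      fun g => AEEqFun.coeFn_zero
    refine ⟨⟨0, fun f K _ => ?_⟩, fun f g => ?_, fun F f _ _ h _ => ?_⟩
    · filter_upwards [hz f] with x hx
      rw [hx]; simp
    · simp
    · have key : ∀ g : LipB X,
          ∫ x, h x * (((0 : LipB X →ₗ[ℝ] Linfty μ) g : Linfty μ) : X →ₘ[μ] ℝ) x ∂μ = 0 := by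
        intro g
        rw [integral_eq_zero_of_ae]
        filter_upwards [hz g] with x hx
        rw [hx]; simp
      simp only [key]
      exact tendsto_const_nhds
  smul_mem' := by
    rintro u d hd
    have hs : ∀ g : LipB X, (fun x => ((u • d) g : X →ₘ[μ] ℝ) x) =ᵐ[μ]
        fun x => (u : X →ₘ[μ] ℝ) x * (d g : X →ₘ[μ] ℝ) x :=
      fun g => AEEqFun.coeFn_mul (u : X →ₘ[μ] ℝ) (d g : X →ₘ[μ] ℝ)
    refine ⟨?_, fun f g => ?_, fun F f hF hlim h hh => ?_⟩
    · obtain ⟨C, hC⟩ := u.2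
      obtain ⟨M, hM⟩ := hd.bounded
      refine ⟨C * M, fun f K hf => ?_⟩
      filter_upwards [hC, hM f K hf, hs f] with x h1 h2 h3
      rw [h3, abs_mul, mul_assoc]
      exact mul_le_mul h1 h2 (abs_nonneg _) ((abs_nonneg _).trans h1)
    · simp only [LinearMap.smul_apply, smul_eq_mul, hd.leibniz]
      ring
    · have key : ∀ g : LipB X, ∫ x, h x * ((u • d) g : X →ₘ[μ] ℝ) x ∂μ =
          ∫ x, (h x * (u : X →ₘ[μ] ℝ) x) * (d g : X →ₘ[μ] ℝ) x ∂μ := by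
        intro g
        refine integral_congr_ae ?_
        filter_upwards [hs g] with x h3
        rw [h3, mul_assoc]
      simp only [key]
      exact hd.weakContinuous F f hF hlim _ (Linfty.integrable_mul u hh)

/-- The rank of `Υ(X, μ)` over `L^∞(X, μ)`: the supremum of the cardinalities of its linearly
independent subsets. -/
def derivationRank {X : Type*} [MetricSpace X] [MeasurableSpace X] [BorelSpace X]
    (μ : Measure X) : Cardinal :=
  Module.rank (Linfty μ) (DerivationModule μ)

/-- `ν` is a tangent measure of `μ` at `a`: a nonzero Radon measure that is the weak-star limit,
tested against compactly supported continuous functions, of `c j` times the push-forward of `μ`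
under `x ↦ (x - a) / r j`, for some `c j > 0` and some `r j > 0` decreasing to `0`. A locally finite
Borel measure on `ℝⁿ` is automatically regular, hence Radon. -/
def IsTangentMeasure {n : ℕ} (μ : Measure (EuclideanSpace ℝ (Fin n)))
    (a : EuclideanSpace ℝ (Fin n)) (ν : Measure (EuclideanSpace ℝ (Fin n))) : Prop :=
  IsLocallyFiniteMeasure ν ∧ ν ≠ 0 ∧
    ∃ c r : ℕ → ℝ, (∀ j, 0 < c j) ∧ (∀ j, 0 < r j) ∧ Antitone r ∧ Tendsto r atTop (𝓝 0) ∧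
      ∀ φ : C_c(EuclideanSpace ℝ (Fin n), ℝ),
        Tendsto
          (fun j => ∫ y, φ y ∂(ENNReal.ofReal (c j) • μ.map (fun x => (r j)⁻¹ • (x - a))))
          atTop (𝓝 (∫ y, φ y ∂ν))

end

noncomputable section

open scoped ContDiff

/-! ### Almost-everywhere calculus in L^∞. -/

namespace Linfty

variable {X : Type*} [MeasurableSpace X] {μ : Measure X}

/-! On C¹ functions a derivation d is a measurable vector field: d f = ∑ⱼ ∂ⱼf · vⱼ almost everywhere
(`IsMetricDerivation.ae_eq_sum_partialDeriv`). This rests on locality and on the boundedness of d.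
The field determines d, because mollification and weak-star continuity pass from smooth to Lipschitz
functions; hence rank ≤ n for every nonzero σ-finite measure. If the rank of μ is n, McCoy's theorem
turns independence of n derivations over L^∞ into linear independence of their n vectors at almost
every point (`ae_eq_zero_of_sum_derivationComponent_eq_zero`).

Weak-star continuity makes the divergence of such a field negligible at small scales
(`IsMetricDerivation.ae_eventually_integral_le`). Otherwise a set of positive measure is covered, up
to a null set, by disjoint arbitrarily small balls, each carrying a 1-Lipschitz function with large
integral of its derivation. Finite sums of these functions stay bounded in Lip_b and tend uniformly
to 0, while their derivations pair with a fixed integrable function above a positive constant.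

By Lebesgue differentiation the field may be replaced near a typical point a by its value at a. The
resulting estimate survives the rescaling that defines tangent measures, so every ν in Tan(μ, a)
satisfies ∫ ∂ᵥφ dν = 0 for each of the n frozen vectors v and all φ in C¹_c
(`integral_partialDeriv_eq_zero_of_isTangentMeasure`). These vectors span ℝⁿ, so all distributional
derivatives of ν vanish. Thus ν is translation invariant, hence a Haar measure, for which the n
coordinate derivatives are independent derivations (`le_derivationRank_of_isAddHaarMeasure`). -/

theorem ext_ae {u v : Linfty μ} (h : ∀ᵐ x ∂μ, (u : X →ₘ[μ] ℝ) x = (v : X →ₘ[μ] ℝ) x) : u = v :=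
  Subtype.ext (AEEqFun.ext h)

theorem coe_add_ae (u v : Linfty μ) : ∀ᵐ x ∂μ, ((u + v : Linfty μ) : X →ₘ[μ] ℝ) x =
    (u : X →ₘ[μ] ℝ) x + (v : X →ₘ[μ] ℝ) x :=
  AEEqFun.coeFn_add (u : X →ₘ[μ] ℝ) (v : X →ₘ[μ] ℝ)

theorem coe_mul_ae (u v : Linfty μ) : ∀ᵐ x ∂μ, ((u * v : Linfty μ) : X →ₘ[μ] ℝ) x =
    (u : X →ₘ[μ] ℝ) x * (v : X →ₘ[μ] ℝ) x :=
  AEEqFun.coeFn_mul (u : X →ₘ[μ] ℝ) (v : X →ₘ[μ] ℝ)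

theorem coe_zero_ae : ∀ᵐ x ∂μ, ((0 : Linfty μ) : X →ₘ[μ] ℝ) x = 0 :=
  AEEqFun.coeFn_zero

theorem coe_smul_ae (c : ℝ) (u : Linfty μ) : ∀ᵐ x ∂μ, ((c • u : Linfty μ) : X →ₘ[μ] ℝ) x =
    c * (u : X →ₘ[μ] ℝ) x :=
  AEEqFun.coeFn_smul c (u : X →ₘ[μ] ℝ)

theorem coe_sum_ae {ι : Type*} (s : Finset ι) (u : ι → Linfty μ) :
    ∀ᵐ x ∂μ, ((∑ i ∈ s, u i : Linfty μ) : X →ₘ[μ] ℝ) x = ∑ i ∈ s, (u i : X →ₘ[μ] ℝ) x := by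
  classical
  induction s using Finset.induction_on with
  | empty => simpa using coe_zero_ae
  | insert a s ha ih =>
    filter_upwards [ih, coe_add_ae (u a) (∑ i ∈ s, u i)] with x h1 h2
    rw [Finset.sum_insert ha, Finset.sum_insert ha, h2, h1]

/-- The class of a bounded measurable function. -/
def ofBounded (f : X → ℝ) (hf : AEStronglyMeasurable f μ) (hb : ∃ C : ℝ, ∀ᵐ x ∂μ, |f x| ≤ C) :
    Linfty μ :=
  ⟨AEEqFun.mk f hf, by
    obtain ⟨C, hC⟩ := hb
    refine ⟨C, ?_⟩
    filter_upwards [hC, AEEqFun.coeFn_mk f hf] with x h1 h2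
    rwa [h2]⟩

theorem coe_ofBounded_ae (f : X → ℝ) (hf : AEStronglyMeasurable f μ)
    (hb : ∃ C : ℝ, ∀ᵐ x ∂μ, |f x| ≤ C) :
    ∀ᵐ x ∂μ, (ofBounded f hf hb : X →ₘ[μ] ℝ) x = f x :=
  AEEqFun.coeFn_mk f hf

/-- An element of `L^∞` vanishes on a set as soon as it annihilates the integrable functions
supported there. -/
theorem ae_eq_zero_on [SigmaFinite μ] (u : Linfty μ) {s : Set X} (hs : MeasurableSet s)
    (h : ∀ g : X → ℝ, Integrable g μ →
      ∫ x, s.indicator g x * (u : X →ₘ[μ] ℝ) x ∂μ = 0) :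
    ∀ᵐ x ∂μ, x ∈ s → (u : X →ₘ[μ] ℝ) x = 0 := by
  have key : ∀ k : ℕ, ∀ᵐ x ∂μ, x ∈ spanningSets μ k → x ∈ s → (u : X →ₘ[μ] ℝ) x = 0 := by
    intro k
    have hk := measurableSet_spanningSets μ k
    have h1 : Integrable ((spanningSets μ k).indicator (fun _ => (1 : ℝ))) μ :=
      (integrable_indicator_iff hk).2
        (integrableOn_const (measure_spanningSets_lt_top μ k).ne)
    have h2 := integrable_mul u h1
    -- The test function is u itself cut off to a spanning set, so the hypothesis says that u² has
    -- integral zero over the part of s in that set.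
    have h3 := h _ h2
    have h4 := integrable_mul u (h2.indicator hs)
    have h5 : ∀ x, s.indicator (fun x => (spanningSets μ k).indicator (fun _ => (1 : ℝ)) x *
        (u : X →ₘ[μ] ℝ) x) x * (u : X →ₘ[μ] ℝ) x =
        (s ∩ spanningSets μ k).indicator (fun x => (u : X →ₘ[μ] ℝ) x ^ 2) x := by
      intro x
      by_cases hx : x ∈ s <;> by_cases hx' : x ∈ spanningSets μ k <;> simp [hx, hx', sq]
    simp only [h5] at h3 h4
    have h6 := (integral_eq_zero_iff_of_nonneg
      (fun x => Set.indicator_nonneg (fun x _ => sq_nonneg _) x) h4).1 h3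
    filter_upwards [h6] with x hx hxk hxs
    simpa [hxk, hxs] using hx
  filter_upwards [ae_all_iff.2 key] with x hx hxs
  obtain ⟨k, hk⟩ := Set.mem_iUnion.1 ((iUnion_spanningSets μ).symm ▸ Set.mem_univ x :
    x ∈ ⋃ i, spanningSets μ i)
  exact hx k hk hxs

end Linfty

/-! ### Locality of derivations. -/

section Derivation

variable {X : Type*} [MetricSpace X]

/-- Bundle a bounded Lipschitz function. -/
def LipB.of (f : X → ℝ) {K : ℝ≥0} (hK : LipschitzWith K f) {C : ℝ} (hC : ∀ x, |f x| ≤ C) :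
    LipB X :=
  ⟨f, ⟨K, hK⟩, C, hC⟩

theorem LipB.continuous (f : LipB X) : Continuous (f : X → ℝ) :=
  f.2.1.choose_spec.continuous

theorem LipB.exists_lipNormLE (f : LipB X) : ∃ K : ℝ≥0, LipNormLE f K := by
  obtain ⟨K, hK⟩ := f.2.1
  obtain ⟨C, hC⟩ := f.2.2
  refine ⟨max K C.toNNReal, hK.weaken (le_max_left _ _), fun x => (hC x).trans ?_⟩
  exact (Real.le_coe_toNNReal C).trans (by exact_mod_cast le_max_right _ _)

/-- Truncation of real numbers to `[-c, c]`. -/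
def truncate (c t : ℝ) : ℝ := max (-c) (min t c)

theorem abs_truncate_le {c : ℝ} (hc : 0 ≤ c) (t : ℝ) : |truncate c t| ≤ c := by
  unfold truncate
  exact abs_le.2 ⟨le_max_left _ _, max_le (by linarith) (min_le_right _ _)⟩

theorem truncate_of_abs_le {c t : ℝ} (h : |t| ≤ c) : truncate c t = t := by
  unfold truncate
  rw [min_eq_left (abs_le.1 h).2, max_eq_right (abs_le.1 h).1]

theorem LipschitzWith.truncate {f : X → ℝ} {K : ℝ≥0} (hf : LipschitzWith K f) (c : ℝ) :
    LipschitzWith K (fun x => _root_.truncate c (f x)) :=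
  (hf.min_const c).const_max (-c)

variable [MeasurableSpace X] [BorelSpace X] {μ : Measure X}

theorem LipB.coe_toLinfty_ae (f : LipB X) :
    ∀ᵐ x ∂μ, (LipB.toLinfty μ f : X →ₘ[μ] ℝ) x = (f : X → ℝ) x :=
  AEEqFun.coeFn_mk _ _

theorem LipB.toLinfty_one : LipB.toLinfty μ (1 : LipB X) = 1 := by
  apply Linfty.ext_ae
  filter_upwards [LipB.coe_toLinfty_ae (μ := μ) (1 : LipB X),
    AEEqFun.coeFn_one (μ := μ) (β := ℝ)] with x h1 h2
  rw [h1]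
  exact h2.symm

namespace IsMetricDerivation

variable {d : LipB X →ₗ[ℝ] Linfty μ}

theorem leibniz_ae (hd : IsMetricDerivation μ d) (f g : LipB X) :
    ∀ᵐ x ∂μ, (d (f * g) : X →ₘ[μ] ℝ) x =
      (f : X → ℝ) x * (d g : X →ₘ[μ] ℝ) x + (g : X → ℝ) x * (d f : X →ₘ[μ] ℝ) x := by
  filter_upwards [Linfty.coe_add_ae (LipB.toLinfty μ f * d g) (LipB.toLinfty μ g * d f),
    Linfty.coe_mul_ae (LipB.toLinfty μ f) (d g), Linfty.coe_mul_ae (LipB.toLinfty μ g) (d f),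
    LipB.coe_toLinfty_ae (μ := μ) f, LipB.coe_toLinfty_ae (μ := μ) g] with x h1 h2 h3 h4 h5
  rw [hd.leibniz, h1, h2, h3, h4, h5]

theorem map_one (hd : IsMetricDerivation μ d) : d 1 = 0 := by
  have h := hd.leibniz 1 1
  rw [LipB.toLinfty_one, one_mul, one_mul] at h
  simpa using h

theorem map_algebraMap (hd : IsMetricDerivation μ d) (c : ℝ) : d (algebraMap ℝ (LipB X) c) = 0 := by
  rw [Algebra.algebraMap_eq_smul_one, map_smul, hd.map_one, smul_zero]

/-- Locality: a derivation of `f` vanishes almost everywhere on the zero set of `f`. -/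
theorem ae_eq_zero_of_eq_zero [SigmaFinite μ] (hd : IsMetricDerivation μ d) (f : LipB X) :
    ∀ᵐ x ∂μ, (f : X → ℝ) x = 0 → (d f : X →ₘ[μ] ℝ) x = 0 := by
  obtain ⟨K, hK, hKb⟩ := LipB.exists_lipNormLE f
  have hε : ∀ m : ℕ, (0 : ℝ) < 1 / ((m : ℝ) + 1) := fun m => Nat.one_div_pos_of_nat
  have hT : ∀ m : ℕ, LipschitzWith K (fun x => truncate (1 / ((m : ℝ) + 1)) ((f : X → ℝ) x)) :=
    fun m => hK.truncate _
  have hTb : ∀ (m : ℕ) x, |truncate (1 / ((m : ℝ) + 1)) ((f : X → ℝ) x)| ≤ 1 / ((m : ℝ) + 1) :=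
    fun m x => abs_truncate_le (hε m).le _
  have hFb : ∀ (m : ℕ) x,
      |(f : X → ℝ) x - truncate (1 / ((m : ℝ) + 1)) ((f : X → ℝ) x)| ≤ K := by
    intro m x
    have := hε m
    have h := abs_le.1 (hKb x)
    have hK0 : (0 : ℝ) ≤ K := K.2
    unfold truncate
    rcases max_cases (-(1 / ((m : ℝ) + 1))) (min ((f : X → ℝ) x) (1 / ((m : ℝ) + 1)))
      with ⟨h1, h2⟩ | ⟨h1, h2⟩ <;>
    rcases min_cases ((f : X → ℝ) x) (1 / ((m : ℝ) + 1)) with ⟨h3, h4⟩ | ⟨h3, h4⟩ <;>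
    rw [h1] <;> rw [abs_le] <;> constructor <;> linarith
  -- F m vanishes where |f| ≤ 1/(m+1), while G m vanishes where |f| ≥ 1/(m+1) and equals 1 on {f =
  -- 0}. Hence G m · F m = 0, and the product rule read on {f = 0} leaves d (F m) = 0 there. The F m
  -- are bounded in Lip_b and tend to f, so d f inherits this by weak-star continuity.
  let F : ℕ → LipB X := fun m => LipB.of (K := K + K)
    (fun x => (f : X → ℝ) x - truncate (1 / ((m : ℝ) + 1)) ((f : X → ℝ) x)) (hK.sub (hT m)) (hFb m)
  let G : ℕ → LipB X := fun m => LipB.of (C := 1)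
    (fun x => max 0 (1 - ((m : ℝ) + 1) * |truncate (1 / ((m : ℝ) + 1)) ((f : X → ℝ) x)|))
    (K := Real.toNNReal (((m : ℝ) + 1) * K))
    (by
      refine LipschitzWith.const_max (LipschitzWith.of_dist_le' fun x y => ?_) 0
      have h1 := (hT m).dist_le_mul x y
      rw [Real.dist_eq] at h1 ⊢
      have h2 := abs_abs_sub_abs_le (truncate (1 / ((m : ℝ) + 1)) ((f : X → ℝ) y))
        (truncate (1 / ((m : ℝ) + 1)) ((f : X → ℝ) x))
      rw [abs_sub_comm] at h1
      have h3 : (0 : ℝ) < (m : ℝ) + 1 := by positivity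
      rw [show ∀ a b c : ℝ, 1 - a * b - (1 - a * c) = a * (c - b) by intros; ring, abs_mul,
        abs_of_pos h3, mul_assoc]
      exact mul_le_mul_of_nonneg_left (h2.trans h1) h3.le)
    (fun x => by
      rw [abs_of_nonneg (le_max_left _ _)]
      have h3 : (0 : ℝ) < (m : ℝ) + 1 := by positivity
      exact max_le zero_le_one (by
        have := mul_nonneg h3.le (abs_nonneg (truncate (1 / ((m : ℝ) + 1)) ((f : X → ℝ) x)))
        linarith))
  have hGF : ∀ m, G m * F m = 0 := by
    intro m
    ext x
    change max 0 (1 - ((m : ℝ) + 1) * |truncate (1 / ((m : ℝ) + 1)) ((f : X → ℝ) x)|) *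
      ((f : X → ℝ) x - truncate (1 / ((m : ℝ) + 1)) ((f : X → ℝ) x)) = 0
    have h3 : (0 : ℝ) < (m : ℝ) + 1 := by positivity
    rcases le_total |(f : X → ℝ) x| (1 / ((m : ℝ) + 1)) with h | h
    · rw [truncate_of_abs_le h, sub_self, mul_zero]
    · have : |truncate (1 / ((m : ℝ) + 1)) ((f : X → ℝ) x)| = 1 / ((m : ℝ) + 1) := by
        unfold truncate
        have := hε m
        rcases le_abs'.1 h with h | h
        · rw [min_eq_left (by linarith), max_eq_left h, abs_neg, abs_of_pos this]
        · rw [min_eq_right h, max_eq_right (by linarith), abs_of_pos this]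
      rw [this, mul_one_div_cancel h3.ne', sub_self, max_self, zero_mul]
  have hloc : ∀ m, ∀ᵐ x ∂μ, (f : X → ℝ) x = 0 → (d (F m) : X →ₘ[μ] ℝ) x = 0 := by
    intro m
    filter_upwards [hd.leibniz_ae (G m) (F m), Linfty.coe_zero_ae (μ := μ)] with x h1 h2 hx
    rw [hGF, map_zero, h2] at h1
    have e1 : (F m : X → ℝ) x = 0 := by
      change (f : X → ℝ) x - truncate (1 / ((m : ℝ) + 1)) ((f : X → ℝ) x) = 0
      rw [truncate_of_abs_le (by rw [hx, abs_zero]; exact (hε m).le), sub_self]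
    have e2 : (G m : X → ℝ) x = 1 := by
      change max 0 (1 - ((m : ℝ) + 1) * |truncate (1 / ((m : ℝ) + 1)) ((f : X → ℝ) x)|) = 1
      rw [truncate_of_abs_le (by rw [hx, abs_zero]; exact (hε m).le), hx]
      simp
    rw [e1, e2] at h1
    linarith
  have hS : MeasurableSet {x | (f : X → ℝ) x = 0} :=
    (LipB.continuous f).measurable (measurableSet_singleton 0)
  refine Linfty.ae_eq_zero_on (d f) hS fun g hg => ?_
  have hw := hd.weakContinuous F f ⟨K + K, fun m => ⟨hK.sub (hT m), fun x =>
    (hFb m x).trans (by push_cast; linarith [K.2])⟩⟩ (fun x => ?_) _ (hg.indicator hS)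
  · refine tendsto_nhds_unique hw ?_
    have : ∀ m, ∫ x, {x | (f : X → ℝ) x = 0}.indicator g x * (d (F m) : X →ₘ[μ] ℝ) x ∂μ = 0 := by
      intro m
      apply integral_eq_zero_of_ae
      filter_upwards [hloc m] with x hx
      by_cases h : (f : X → ℝ) x = 0
      · simp [hx h]
      · simp [h]
    simp only [this]
    exact tendsto_const_nhds
  · have h0 : Tendsto (fun m : ℕ => truncate (1 / ((m : ℝ) + 1)) ((f : X → ℝ) x)) atTop (𝓝 0) :=
      squeeze_zero_norm (fun m => hTb m x) tendsto_one_div_add_atTop_nhds_zero_nat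
    have h1 := (tendsto_const_nhds (x := (f : X → ℝ) x)).sub h0
    rwa [sub_zero] at h1

theorem ae_eq_of_eq [SigmaFinite μ] (hd : IsMetricDerivation μ d) (f g : LipB X) :
    ∀ᵐ x ∂μ, (f : X → ℝ) x = (g : X → ℝ) x →
      (d f : X →ₘ[μ] ℝ) x = (d g : X →ₘ[μ] ℝ) x := by
  filter_upwards [hd.ae_eq_zero_of_eq_zero (f + (-1 : ℝ) • g),
    Linfty.coe_add_ae (d f) ((-1 : ℝ) • d g), Linfty.coe_smul_ae (-1) (d g)] with x h1 h2 h3 h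
  have h4 := h1 (by
    change (f : X → ℝ) x + (-1 : ℝ) • (g : X → ℝ) x = 0
    rw [h]; simp)
  rw [map_add, map_smul, h2, h3] at h4
  linarith

/-- A derivation is controlled by local Lipschitz constants. -/
theorem ae_abs_le_of_lipschitzOnWith_ball [SigmaFinite μ] (hd : IsMetricDerivation μ d) {M : ℝ}
    (hM : ∀ (f : LipB X) (K : ℝ≥0), LipNormLE f K → ∀ᵐ x ∂μ, |(d f : X →ₘ[μ] ℝ) x| ≤ M * K)
    (f : LipB X) {p : X} {ρ : ℝ} (hρ : 0 < ρ) (hρ1 : ρ ≤ 1) {ε : ℝ≥0}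
    (hf : LipschitzOnWith ε (f : X → ℝ) (Metric.ball p ρ)) :
    ∀ᵐ x ∂μ, x ∈ Metric.ball p ρ → |(d f : X →ₘ[μ] ℝ) x| ≤ M * ε := by
  obtain ⟨g, hg, hfg⟩ := hf.extend_real
  let c := (f : X → ℝ) p
  -- Subtracting the value at p and truncating at ε makes the whole Lip norm at most ε, not only the
  -- Lipschitz constant. On the ball the truncation does nothing, because the radius is at most 1;
  -- the constant is invisible to d.
  have hg' : LipschitzWith ε (fun x => truncate ε (g x - c)) := by
    simpa using ((hg.sub (LipschitzWith.const c)).truncate ε)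
  let G : LipB X := LipB.of _ hg' (fun x => abs_truncate_le ε.2 _)
  have hG : LipNormLE G ε := ⟨hg', fun x => abs_truncate_le ε.2 _⟩
  filter_upwards [hM G ε hG, hd.ae_eq_of_eq (G + algebraMap ℝ (LipB X) c) f] with x h1 h2 hx
  rw [map_add, hd.map_algebraMap, add_zero] at h2
  rw [← h2]
  · exact h1
  · change truncate ε (g x - c) + c = _
    have hp : p ∈ Metric.ball p ρ := Metric.mem_ball_self hρ
    rw [truncate_of_abs_le, sub_add_cancel, hfg hx]
    have h3 : c = g p := hfg hp
    rw [h3, ← Real.dist_eq]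
    refine (hg.dist_le_mul x p).trans ?_
    have h4 : dist x p ≤ 1 := (Metric.mem_ball.1 hx).le.trans hρ1
    nlinarith [ε.2]

end IsMetricDerivation

end Derivation

/-! ### Smooth approximation and bounded coordinates. -/

/-- Mollification of a bounded Lipschitz function. -/
theorem LipschitzWith.exists_contDiff_approx {E : Type*} [NormedAddCommGroup E] [NormedSpace ℝ E]
    [FiniteDimensional ℝ E] {f : E → ℝ} {K : ℝ≥0} (hf : LipschitzWith K f) {C : ℝ}
    (hC : ∀ x, |f x| ≤ C) {ε : ℝ} (hε : 0 < ε) :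
    ∃ g : E → ℝ, ContDiff ℝ ∞ g ∧ LipschitzWith K g ∧ (∀ x, |g x| ≤ C) ∧
      ∀ x, dist (g x) (f x) ≤ K * ε := by
  borelize E
  let μ : Measure E := Measure.addHaar
  let φ : ContDiffBump (0 : E) := ⟨ε / 2, ε, half_pos hε, half_lt_self hε⟩
  -- The kernel is nonnegative of mass one, so g averages translates of f and keeps both the
  -- Lipschitz constant and the bound.
  let g : E → ℝ := convolution (φ.normed μ) f (ContinuousLinearMap.lsmul ℝ ℝ) μ
  have hg : ∀ x, g x = ∫ t, φ.normed μ t * f (x - t) ∂μ := fun x => by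
    simp [g, convolution]
  have hint : ∀ x, Integrable (fun t => φ.normed μ t * f (x - t)) μ := fun x =>
    (φ.continuous_normed.mul (hf.continuous.comp (continuous_const.sub continuous_id))
      ).integrable_of_hasCompactSupport φ.hasCompactSupport_normed.mul_right
  have hφ : Integrable (φ.normed μ) μ :=
    φ.continuous_normed.integrable_of_hasCompactSupport φ.hasCompactSupport_normed
  refine ⟨g, φ.hasCompactSupport_normed.contDiff_convolution_left _ φ.contDiff_normed
    hf.continuous.locallyIntegrable, LipschitzWith.of_dist_le_mul fun x y => ?_, fun x => ?_,
    fun x => φ.dist_normed_convolution_le hf.continuous.aestronglyMeasurable fun y hy =>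
      (hf.dist_le_mul y x).trans (mul_le_mul_of_nonneg_left (Metric.mem_ball.1 hy).le K.2)⟩
  · rw [hg, hg, dist_eq_norm, ← integral_sub (hint x) (hint y)]
    have h1 := norm_integral_le_of_norm_le (μ := μ)
      (f := fun t => φ.normed μ t * f (x - t) - φ.normed μ t * f (y - t))
      (hφ.mul_const (K * dist x y)) (Eventually.of_forall fun t => ?_)
    · rwa [integral_mul_const, φ.integral_normed, one_mul] at h1
    · rw [← mul_sub, norm_mul, Real.norm_of_nonneg (φ.nonneg_normed t), ← dist_eq_norm]
      refine mul_le_mul_of_nonneg_left ?_ (φ.nonneg_normed t)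
      simpa using hf.dist_le_mul (x - t) (y - t)
  · rw [hg, ← Real.norm_eq_abs]
    have h1 := norm_integral_le_of_norm_le (μ := μ) (f := fun t => φ.normed μ t * f (x - t))
      (hφ.mul_const C) (Eventually.of_forall fun t => ?_)
    · rwa [integral_mul_const, φ.integral_normed, one_mul] at h1
    · rw [norm_mul, Real.norm_of_nonneg (φ.nonneg_normed t)]
      exact mul_le_mul_of_nonneg_left (hC _) (φ.nonneg_normed t)

/-- Coordinate functions are unbounded, so they are replaced by their arctangents. These have
nowhere vanishing derivative, and the factor 1 + xⱼ² recovers the components of the vector field. -/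
theorem Real.lipschitzWith_arctan : LipschitzWith 1 Real.arctan := by
  refine lipschitzWith_of_nnnorm_deriv_le Real.differentiable_arctan fun x => ?_
  rw [Real.deriv_arctan, ← NNReal.coe_le_coe, coe_nnnorm, Real.norm_of_nonneg (by positivity)]
  rw [NNReal.coe_one, div_le_one (by positivity)]
  nlinarith [sq_nonneg x]

/-! ### Derivations as vector fields. -/

section Euclidean

variable {n : ℕ}

theorem EuclideanSpace.lipschitzWith_apply (j : Fin n) :
    LipschitzWith 1 (fun x : EuclideanSpace ℝ (Fin n) => x j) := by
  refine LipschitzWith.of_dist_le_mul fun x y => ?_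
  rw [NNReal.coe_one, one_mul, dist_eq_norm, dist_eq_norm]
  exact PiLp.norm_apply_le (x - y) j

theorem LipschitzWith.arctan_apply (j : Fin n) :
    LipschitzWith 1 (fun x : EuclideanSpace ℝ (Fin n) => Real.arctan (x j)) := by
  have h := Real.lipschitzWith_arctan.comp (EuclideanSpace.lipschitzWith_apply j)
  rw [one_mul] at h
  exact h

/-- The bounded coordinate functions `x ↦ arctan (x j)`. -/
def boundedCoord (j : Fin n) : LipB (EuclideanSpace ℝ (Fin n)) :=
  LipB.of (K := 1) (C := 2) (fun x => Real.arctan (x j))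
    (LipschitzWith.arctan_apply j)
    (fun x => by
      have h1 := Real.arctan_lt_pi_div_two (x j)
      have h2 := Real.neg_pi_div_two_lt_arctan (x j)
      have h3 := Real.pi_le_four
      exact abs_le.2 ⟨by linarith, by linarith⟩)

theorem lipNormLE_boundedCoord (j : Fin n) : LipNormLE (boundedCoord j) 2 :=
  ⟨LipschitzWith.weaken (LipschitzWith.arctan_apply j)
    (by norm_num : (1 : ℝ≥0) ≤ 2), fun x => by
      have h1 := Real.arctan_lt_pi_div_two (x j)
      have h2 := Real.neg_pi_div_two_lt_arctan (x j)
      have h3 := Real.pi_le_four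
      exact abs_le.2 ⟨by push_cast; change _ ≤ Real.arctan (x j); linarith,
        by push_cast; change Real.arctan (x j) ≤ _; linarith⟩⟩

/-- Strict differentiability is what matters: a function with zero strict derivative at p has
arbitrarily small Lipschitz constant near p. -/
theorem hasStrictFDerivAt_boundedCoord (j : Fin n) (p : EuclideanSpace ℝ (Fin n)) :
    HasStrictFDerivAt (boundedCoord j : EuclideanSpace ℝ (Fin n) → ℝ)
      ((1 / (1 + p j ^ 2)) • (EuclideanSpace.proj j : EuclideanSpace ℝ (Fin n) →L[ℝ] ℝ)) p :=
  HasStrictDerivAt.comp_hasStrictFDerivAt (h₂ := Real.arctan)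
    (f := fun x : EuclideanSpace ℝ (Fin n) => x j) p (Real.hasStrictDerivAt_arctan (p j))
    (EuclideanSpace.proj j : EuclideanSpace ℝ (Fin n) →L[ℝ] ℝ).hasStrictFDerivAt

variable {μ : Measure (EuclideanSpace ℝ (Fin n))}

/-- The components of the vector field representing a derivation on smooth functions. -/
def derivationComponent (d : LipB (EuclideanSpace ℝ (Fin n)) →ₗ[ℝ] Linfty μ) (j : Fin n)
    (x : EuclideanSpace ℝ (Fin n)) : ℝ :=
  (1 + x j ^ 2) * (d (boundedCoord j) : EuclideanSpace ℝ (Fin n) →ₘ[μ] ℝ) x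

/-- The partial derivative `∂ⱼ f`. -/
def partialDeriv (f : EuclideanSpace ℝ (Fin n) → ℝ) (j : Fin n) (x : EuclideanSpace ℝ (Fin n)) :
    ℝ :=
  fderiv ℝ f x (EuclideanSpace.single j 1)

theorem fderiv_apply_eq_sum (f : EuclideanSpace ℝ (Fin n) → ℝ) (x v : EuclideanSpace ℝ (Fin n)) :
    fderiv ℝ f x v = ∑ j, partialDeriv f j x * v j := by
  have h : v = ∑ j, v j • EuclideanSpace.single j (1 : ℝ) := by
    ext i
    simp [Finset.sum_apply, Pi.single_apply]
  conv_lhs => rw [h]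
  rw [map_sum]
  refine Finset.sum_congr rfl fun j _ => ?_
  rw [map_smul, smul_eq_mul, mul_comm, partialDeriv]

/-- Near p, f differs from a linear combination of bounded coordinates, with coefficients frozen at
p, by a function of small Lipschitz constant. Its derivation is then small near p; unfreezing the
continuous coefficients costs another small error. The error bounds are local, and the smallness
parameter tends to 0 at the end. -/
theorem IsMetricDerivation.ae_eq_sum_partialDeriv [SigmaFinite μ]
    {d : LipB (EuclideanSpace ℝ (Fin n)) →ₗ[ℝ] Linfty μ} (hd : IsMetricDerivation μ d)
    (f : LipB (EuclideanSpace ℝ (Fin n)))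
    (hf : ContDiff ℝ 1 (f : EuclideanSpace ℝ (Fin n) → ℝ)) :
    ∀ᵐ x ∂μ, (d f : EuclideanSpace ℝ (Fin n) →ₘ[μ] ℝ) x =
      ∑ j, partialDeriv f j x * derivationComponent d j x := by
  obtain ⟨M, hM⟩ := hd.bounded
  let c : Fin n → EuclideanSpace ℝ (Fin n) → ℝ := fun j x => (1 + x j ^ 2) * partialDeriv f j x
  have hc : ∀ j, Continuous (c j) := fun j =>
    (continuous_const.add ((EuclideanSpace.lipschitzWith_apply j).continuous.pow 2)).mul
      ((hf.continuous_fderiv one_ne_zero).clm_apply continuous_const)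
  have hu : ∀ᵐ x ∂μ, ∀ j, |(d (boundedCoord j) : EuclideanSpace ℝ (Fin n) →ₘ[μ] ℝ) x| ≤ M * 2 :=
    ae_all_iff.2 fun j => by simpa using hM _ _ (lipNormLE_boundedCoord j)
  have key : ∀ ε : ℝ≥0, 0 < ε → ∀ᵐ x ∂μ, |(d f : EuclideanSpace ℝ (Fin n) →ₘ[μ] ℝ) x -
      ∑ j, c j x * (d (boundedCoord j) : EuclideanSpace ℝ (Fin n) →ₘ[μ] ℝ) x| ≤
      (M + n * (M * 2)) * ε := by
    intro ε hε
    refine measure_null_of_locally_null _ fun p _ => ?_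
    -- The factor 1 + pⱼ² in c j p cancels the derivative of arctan at pⱼ, so g has zero derivative
    -- at p.
    let g : LipB (EuclideanSpace ℝ (Fin n)) := f + ∑ j, (-c j p) • boundedCoord j
    have hg : HasStrictFDerivAt (g : EuclideanSpace ℝ (Fin n) → ℝ)
        (0 : EuclideanSpace ℝ (Fin n) →L[ℝ] ℝ) p := by
      have h1 := (hf.contDiffAt (x := p)).hasStrictFDerivAt one_ne_zero
      have h2 := HasStrictFDerivAt.fun_sum (u := Finset.univ) fun j _ =>
        (hasStrictFDerivAt_boundedCoord j p).const_smul (-c j p)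
      have h3 := h1.add h2
      have e1 : fderiv ℝ (f : EuclideanSpace ℝ (Fin n) → ℝ) p + ∑ j, -c j p •
          ((1 / (1 + p j ^ 2)) • (EuclideanSpace.proj j : EuclideanSpace ℝ (Fin n) →L[ℝ] ℝ))
          = 0 := by
        ext v
        simp only [add_apply, sum_apply, smul_apply, zero_apply, smul_eq_mul]
        rw [fderiv_apply_eq_sum, ← Finset.sum_add_distrib]
        refine Finset.sum_eq_zero fun j _ => ?_
        have : (1 + p j ^ 2) ≠ 0 := by positivity
        have e : (EuclideanSpace.proj j : EuclideanSpace ℝ (Fin n) →L[ℝ] ℝ) v = v j := rfl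
        simp only [c, e]
        field_simp
        ring
      rw [e1] at h3
      refine h3.congr_of_eventuallyEq (Eventually.of_forall fun x => ?_)
      simp [g, Finset.sum_apply]
    obtain ⟨s, hs, hsg⟩ := hg.exists_lipschitzOnWith_of_nnnorm_lt ε (by simpa using hε)
    have hcont : ∀ᶠ x in 𝓝 p, ∀ j, |c j x - c j p| < ε := by
      rw [eventually_all]
      intro j
      have := Metric.tendsto_nhds.1 ((hc j).tendsto p) ε (by exact_mod_cast hε)
      simpa [Real.dist_eq] using this
    obtain ⟨ρ, hρ, hball⟩ := Metric.mem_nhds_iff.1 (Filter.inter_mem hs hcont)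
    let ρ' := min ρ 1
    have hρ' : 0 < ρ' := lt_min hρ one_pos
    have hsub : Metric.ball p ρ' ⊆ Metric.ball p ρ := Metric.ball_subset_ball (min_le_left _ _)
    refine ⟨_, Filter.inter_mem self_mem_nhdsWithin
      (mem_nhdsWithin_of_mem_nhds (Metric.ball_mem_nhds p hρ')), ?_⟩
    have h1 := hd.ae_abs_le_of_lipschitzOnWith_ball hM g hρ' (min_le_right _ _)
      (hsg.mono fun x hx => (hball (hsub hx)).1)
    have e2 : d g = d f + ∑ j, (-c j p) • d (boundedCoord j) := by
      simp [g]
    rw [e2] at h1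
    suffices hs : ∀ᵐ x ∂μ, x ∈ Metric.ball p ρ' →
        |(d f : EuclideanSpace ℝ (Fin n) →ₘ[μ] ℝ) x -
        ∑ j, c j x * (d (boundedCoord j) : EuclideanSpace ℝ (Fin n) →ₘ[μ] ℝ) x| ≤
        (M + n * (M * 2)) * ε by
      refine measure_mono_null ?_ (ae_iff.1 hs)
      rintro x ⟨hx1, hx2⟩ h
      exact hx1 (h hx2)
    filter_upwards [h1, hu, Linfty.coe_add_ae (d f) (∑ j, (-c j p) • d (boundedCoord j)),
      Linfty.coe_sum_ae Finset.univ (fun j => (-c j p) • d (boundedCoord j)),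
      ae_all_iff.2 fun j => Linfty.coe_smul_ae (-c j p) (d (boundedCoord j))]
      with x h1 h2 h3 h4 h5 hx
    have h6 := h1 hx
    rw [h3, h4, Finset.sum_congr rfl fun j _ => h5 j] at h6
    have h7 : ∑ j, |(c j p - c j x) *
        (d (boundedCoord j) : EuclideanSpace ℝ (Fin n) →ₘ[μ] ℝ) x| ≤ n * (M * 2) * ε := by
      have h8 : ∀ j ∈ Finset.univ, |(c j p - c j x) *
          (d (boundedCoord j) : EuclideanSpace ℝ (Fin n) →ₘ[μ] ℝ) x| ≤ M * 2 * ε := fun j _ => by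
        rw [abs_mul, abs_sub_comm, mul_comm]
        exact mul_le_mul (h2 j) ((hball (hsub hx)).2 j).le (abs_nonneg _)
          ((abs_nonneg _).trans (h2 j))
      refine (Finset.sum_le_sum h8).trans (le_of_eq ?_)
      simp
      ring
    have h9 : (d f : EuclideanSpace ℝ (Fin n) →ₘ[μ] ℝ) x -
        ∑ j, c j x * (d (boundedCoord j) : EuclideanSpace ℝ (Fin n) →ₘ[μ] ℝ) x =
        ((d f : EuclideanSpace ℝ (Fin n) →ₘ[μ] ℝ) x +
          ∑ j, -c j p * (d (boundedCoord j) : EuclideanSpace ℝ (Fin n) →ₘ[μ] ℝ) x) +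
        ∑ j, (c j p - c j x) *
          (d (boundedCoord j) : EuclideanSpace ℝ (Fin n) →ₘ[μ] ℝ) x := by
      rw [add_assoc, ← Finset.sum_add_distrib, sub_eq_add_neg, ← Finset.sum_neg_distrib]
      congr 1
      exact Finset.sum_congr rfl fun j _ => by ring
    rw [h9, add_mul]
    exact (abs_add_le _ _).trans (add_le_add h6 ((Finset.abs_sum_le_sum_abs _ _).trans h7))
  have key2 : ∀ᵐ x ∂μ, ∀ m : ℕ, |(d f : EuclideanSpace ℝ (Fin n) →ₘ[μ] ℝ) x -
      ∑ j, c j x * (d (boundedCoord j) : EuclideanSpace ℝ (Fin n) →ₘ[μ] ℝ) x| ≤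
      (M + n * (M * 2)) * (1 / ((m : ℝ) + 1)) := ae_all_iff.2 fun m => by
    simpa using key (1 / ((m : ℝ≥0) + 1)) (by positivity)
  filter_upwards [key2] with x hx
  have h0 := ge_of_tendsto' ((tendsto_one_div_add_atTop_nhds_zero_nat (𝕜 := ℝ)).const_mul
    (M + n * (M * 2))) hx
  rw [mul_zero] at h0
  have h1 := sub_eq_zero.1 (abs_eq_zero.1 (le_antisymm h0 (abs_nonneg _)))
  rw [h1]
  refine Finset.sum_congr rfl fun j _ => ?_
  simp only [c, derivationComponent]
  ring

/-- A derivation that annihilates the coordinates is zero. -/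
theorem IsMetricDerivation.eq_zero_of_boundedCoord [SigmaFinite μ]
    {d : LipB (EuclideanSpace ℝ (Fin n)) →ₗ[ℝ] Linfty μ} (hd : IsMetricDerivation μ d)
    (h : ∀ j, d (boundedCoord j) = 0) : d = 0 := by
  have hcomp : ∀ᵐ x ∂μ, ∀ j, derivationComponent d j x = 0 := ae_all_iff.2 fun j => by
    filter_upwards [Linfty.coe_zero_ae (μ := μ)] with x hx
    rw [derivationComponent, h j, hx, mul_zero]
  refine LinearMap.ext fun f => Linfty.ext_ae ?_
  obtain ⟨K, hK, hKb⟩ := LipB.exists_lipNormLE f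
  have hε : ∀ m : ℕ, (0 : ℝ) < 1 / ((m : ℝ) + 1) := fun m => Nat.one_div_pos_of_nat
  -- The mollifications share the Lip bound K of f and converge to it, so weak-star continuity
  -- applies.
  choose g hg hgK hgb hgf using fun m : ℕ => hK.exists_contDiff_approx hKb (hε m)
  let F : ℕ → LipB (EuclideanSpace ℝ (Fin n)) := fun m => LipB.of (g m) (hgK m) (hgb m)
  have hF : ∀ m, ∀ᵐ x ∂μ, (d (F m) : EuclideanSpace ℝ (Fin n) →ₘ[μ] ℝ) x = 0 := by
    intro m
    filter_upwards [hcomp, hd.ae_eq_sum_partialDeriv (F m) ((hg m).of_le (by simp))] with x h1 h2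
    rw [h2]
    exact Finset.sum_eq_zero fun j _ => by rw [h1 j, mul_zero]
  have h0 := Linfty.ae_eq_zero_on (d f) MeasurableSet.univ fun h hh => by
    have hw := hd.weakContinuous F f ⟨K, fun m => ⟨hgK m, hgb m⟩⟩ (fun x => by
      refine tendsto_iff_dist_tendsto_zero.2 (squeeze_zero (fun _ => dist_nonneg)
        (fun m => hgf m x) ?_)
      simpa using (tendsto_one_div_add_atTop_nhds_zero_nat (𝕜 := ℝ)).const_mul (K : ℝ)) h hh
    simp only [Set.indicator_univ]
    refine tendsto_nhds_unique hw ?_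
    have : ∀ m, ∫ x, h x * (d (F m) : EuclideanSpace ℝ (Fin n) →ₘ[μ] ℝ) x ∂μ = 0 := fun m => by
      apply integral_eq_zero_of_ae
      filter_upwards [hF m] with x hx
      simp [hx]
    simp only [this]
    exact tendsto_const_nhds
  filter_upwards [h0, Linfty.coe_zero_ae (μ := μ)] with x h1 h2
  rw [h1 trivial]
  exact h2.symm

end Euclidean

/-! ### Negligible divergence at small scales. -/

/-- A finite sum of `K`-Lipschitz functions vanishing off pairwise disjoint sets is
`2K`-Lipschitz. -/
theorem LipschitzWith.sum_of_pairwiseDisjoint {X ι : Type*} [PseudoMetricSpace X] {K : ℝ≥0}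
    (t : Finset ι) (B : ι → Set X) (hB : (t : Set ι).PairwiseDisjoint B) (f : ι → X → ℝ)
    (hf : ∀ i ∈ t, LipschitzWith K (f i)) (hfB : ∀ i ∈ t, ∀ x ∉ B i, f i x = 0) :
    LipschitzWith (2 * K) (fun x => ∑ i ∈ t, f i x) := by
  classical
  -- Each of two given points lies in at most one B i, so at most two summands contribute to a
  -- difference; hence the factor 2.
  have hunique : ∀ x, ∑ i ∈ t with x ∈ B i, (1 : ℝ) ≤ 1 := by
    intro x
    rw [Finset.sum_const, nsmul_eq_mul, mul_one]
    have : (t.filter fun i => x ∈ B i).card ≤ 1 := by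
      refine Finset.card_le_one.2 fun i hi j hj => ?_
      rw [Finset.mem_filter] at hi hj
      by_contra hne
      exact Set.disjoint_left.1 (hB hi.1 hj.1 hne) hi.2 hj.2
    exact_mod_cast this
  refine LipschitzWith.of_dist_le_mul fun x y => ?_
  rw [Real.dist_eq, ← Finset.sum_sub_distrib]
  have hterm : ∀ i ∈ t, |f i x - f i y| ≤
      ((if x ∈ B i then 1 else 0) + (if y ∈ B i then 1 else 0)) * (K * dist x y) := by
    intro i hi
    have h1 := (hf i hi).dist_le_mul x y
    rw [Real.dist_eq] at h1
    have h0 : 0 ≤ K * dist x y := by positivity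
    by_cases hx : x ∈ B i <;> by_cases hy : y ∈ B i <;> simp only [hx, hy, if_true, if_false]
    · linarith
    · linarith
    · linarith
    · rw [hfB i hi x hx, hfB i hi y hy]
      simp
  refine (Finset.abs_sum_le_sum_abs _ _).trans ((Finset.sum_le_sum hterm).trans ?_)
  rw [← Finset.sum_mul, Finset.sum_add_distrib, ← Finset.sum_filter, ← Finset.sum_filter]
  have h2 := hunique x
  have h3 := hunique y
  have h0 : 0 ≤ K * dist x y := by positivity
  push_cast
  nlinarith

theorem abs_sum_le_of_pairwiseDisjoint {X ι : Type*} {c : ℝ} (hc : 0 ≤ c)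
    (t : Finset ι) (B : ι → Set X) (hB : (t : Set ι).PairwiseDisjoint B) (f : ι → X → ℝ)
    (hf : ∀ i ∈ t, ∀ x, |f i x| ≤ c) (hfB : ∀ i ∈ t, ∀ x ∉ B i, f i x = 0) (x : X) :
    |∑ i ∈ t, f i x| ≤ c := by
  by_cases h : ∃ i ∈ t, x ∈ B i
  · obtain ⟨i, hi, hx⟩ := h
    rw [Finset.sum_eq_single_of_mem i hi fun j hj hne =>
      hfB j hj x fun hxj => Set.disjoint_left.1 (hB hj hi hne) hxj hx]
    exact hf i hi x
  · push Not at h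
    rw [Finset.sum_eq_zero fun i hi => hfB i hi x (h i hi), abs_zero]
    exact hc

section Euclidean

variable {n : ℕ} {μ : Measure (EuclideanSpace ℝ (Fin n))}

/-- The functions which are `1`-Lipschitz, supported in the closed ball `B(a, ρ)` and bounded by
`ρ`. -/
def IsBallTest (a : EuclideanSpace ℝ (Fin n)) (ρ : ℝ) (f : EuclideanSpace ℝ (Fin n) → ℝ) : Prop :=
  LipschitzWith 1 f ∧ (∀ x, |f x| ≤ ρ) ∧ ∀ x ∉ Metric.closedBall a ρ, f x = 0

/-- At almost every point, the divergence of a derivation is negligible at small scales. -/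
theorem IsMetricDerivation.ae_eventually_integral_le [IsLocallyFiniteMeasure μ]
    {d : LipB (EuclideanSpace ℝ (Fin n)) →ₗ[ℝ] Linfty μ} (hd : IsMetricDerivation μ d)
    {h : EuclideanSpace ℝ (Fin n) → ℝ} (hh : Integrable h μ) {η : ℝ} (hη : 0 < η) :
    ∀ᵐ a ∂μ, ∃ ρ₀ > 0, ∀ ρ ∈ Set.Ioo 0 ρ₀, ∀ f : LipB (EuclideanSpace ℝ (Fin n)),
      IsBallTest a ρ (f : EuclideanSpace ℝ (Fin n) → ℝ) →
      ∫ x, h x * (d f : EuclideanSpace ℝ (Fin n) →ₘ[μ] ℝ) x ∂μ ≤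
        η * μ.real (Metric.closedBall a ρ) := by
  rw [ae_iff]
  set s := {a | ¬ ∃ ρ₀ > 0, ∀ ρ ∈ Set.Ioo 0 ρ₀, ∀ f : LipB (EuclideanSpace ℝ (Fin n)),
      IsBallTest a ρ (f : EuclideanSpace ℝ (Fin n) → ℝ) →
      ∫ x, h x * (d f : EuclideanSpace ℝ (Fin n) →ₘ[μ] ℝ) x ∂μ ≤
        η * μ.real (Metric.closedBall a ρ)} with hs
  by_contra hpos
  -- A finite positive c strictly below μ s allows for μ s = ∞ and lets finitely many balls suffice.
  obtain ⟨c, hc0, hcs⟩ := exists_between (pos_iff_ne_zero.2 hpos)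
  have hctop : c ≠ ⊤ := (hcs.trans_le le_top).ne
  let bad : EuclideanSpace ℝ (Fin n) → Set ℝ := fun a =>
    {ρ | ∃ f : LipB (EuclideanSpace ℝ (Fin n)), IsBallTest a ρ (f : EuclideanSpace ℝ (Fin n) → ℝ) ∧
      η * μ.real (Metric.closedBall a ρ) <
        ∫ x, h x * (d f : EuclideanSpace ℝ (Fin n) →ₘ[μ] ℝ) x ∂μ}
  have hbad : ∀ a ∈ s, ∀ δ > 0, (bad a ∩ Set.Ioo 0 δ).Nonempty := by
    intro a ha δ hδ
    simp only [hs, Set.mem_ofPred_eq] at ha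
    push Not at ha
    obtain ⟨ρ, hρ, f, hf, hlt⟩ := ha δ hδ
    exact ⟨ρ, ⟨f, hf, hlt⟩, hρ⟩
  have hF : ∀ m : ℕ, ∃ F : LipB (EuclideanSpace ℝ (Fin n)),
      LipschitzWith 2 (F : EuclideanSpace ℝ (Fin n) → ℝ) ∧
      (∀ x, |(F : EuclideanSpace ℝ (Fin n) → ℝ) x| ≤ 1 / ((m : ℝ) + 1)) ∧
      η * c.toReal ≤ ∫ x, h x * (d F : EuclideanSpace ℝ (Fin n) →ₘ[μ] ℝ) x ∂μ := by
    intro m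
    have hm : (0 : ℝ) < 1 / ((m : ℝ) + 1) := Nat.one_div_pos_of_nat
    -- Besicovitch's theorem needs neither measurability of s nor a doubling condition on μ. Capping
    -- the radii at 1/(m+1) makes the test functions uniformly small.
    obtain ⟨t, r, htc, hts, hr, hcov, hdisj⟩ := Besicovitch.exists_disjoint_closedBall_covering_ae
      μ bad s hbad (fun _ => 1 / ((m : ℝ) + 1)) (fun _ _ => hm)
    have hct : c < ∑' a : t, μ (Metric.closedBall (a : EuclideanSpace ℝ (Fin n)) (r a)) := by
      refine hcs.trans_le ?_
      calc μ s ≤ μ (⋃ a ∈ t, Metric.closedBall a (r a)) := by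
            refine measure_mono_ae ?_
            rw [ae_le_set]
            exact hcov
        _ ≤ _ := measure_biUnion_le μ htc _
    rw [ENNReal.tsum_eq_iSup_sum] at hct
    obtain ⟨T, hT⟩ := lt_iSup_iff.1 hct
    have hr' : ∀ a : t, r a ∈ bad a := fun a => (hr a a.2).1
    choose f hf hlt using hr'
    have hdisj' : (T : Set t).PairwiseDisjoint
        (fun a => Metric.closedBall (a : EuclideanSpace ℝ (Fin n)) (r a)) :=
      fun a _ b _ hab => hdisj a.2 b.2 fun e => hab (Subtype.ext e)
    have hlip := LipschitzWith.sum_of_pairwiseDisjoint (K := 1) T _ hdisj'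
      (fun a => (f a : EuclideanSpace ℝ (Fin n) → ℝ)) (fun a _ => (hf a).1) (fun a _ => (hf a).2.2)
    have hbd := abs_sum_le_of_pairwiseDisjoint hm.le T _ hdisj'
      (fun a => (f a : EuclideanSpace ℝ (Fin n) → ℝ))
      (fun a _ x => ((hf a).2.1 x).trans (hr a a.2).2.2.le) (fun a _ => (hf a).2.2)
    have e : ((∑ a ∈ T, f a : LipB (EuclideanSpace ℝ (Fin n))) : EuclideanSpace ℝ (Fin n) → ℝ) =
        fun x => ∑ a ∈ T, (f a : EuclideanSpace ℝ (Fin n) → ℝ) x := by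
      ext x
      simp [Finset.sum_apply]
    refine ⟨∑ a ∈ T, f a, ?_, ?_, ?_⟩
    · rw [e]
      simpa using hlip
    · rw [e]
      exact hbd
    · have h1 : ∫ x, h x * (d (∑ a ∈ T, f a) : EuclideanSpace ℝ (Fin n) →ₘ[μ] ℝ) x ∂μ =
          ∑ a ∈ T, ∫ x, h x * (d (f a) : EuclideanSpace ℝ (Fin n) →ₘ[μ] ℝ) x ∂μ := by
        rw [← integral_finsetSum _ fun a _ => Linfty.integrable_mul _ hh]
        refine integral_congr_ae ?_
        filter_upwards [Linfty.coe_sum_ae T (fun a => d (f a))] with x hx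
        rw [map_sum, hx, Finset.mul_sum]
      rw [h1]
      have hfin : ∀ a ∈ T, μ (Metric.closedBall (a : EuclideanSpace ℝ (Fin n)) (r a)) ≠ ⊤ :=
        fun a _ => measure_closedBall_lt_top.ne
      calc η * c.toReal ≤ η * (∑ a ∈ T,
            μ (Metric.closedBall (a : EuclideanSpace ℝ (Fin n)) (r a))).toReal :=
            mul_le_mul_of_nonneg_left
              (ENNReal.toReal_mono (ENNReal.sum_ne_top.2 hfin) hT.le) hη.le
        _ = ∑ a ∈ T, η * μ.real (Metric.closedBall (a : EuclideanSpace ℝ (Fin n)) (r a)) := by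
            rw [ENNReal.toReal_sum hfin, Finset.mul_sum]
            rfl
        _ ≤ _ := Finset.sum_le_sum fun a _ => (hlt a).le
  choose F hF2 hFb hFc using hF
  -- The F m tend to 0 with bounded Lip norm, so their pairings with h tend to 0, against the lower
  -- bound η·c.
  have hw := hd.weakContinuous F 0 ⟨2, fun m => ⟨hF2 m, fun x => (hFb m x).trans ?_⟩⟩
    (fun x => ?_) h hh
  · have h0 : ∫ x, h x * (d 0 : EuclideanSpace ℝ (Fin n) →ₘ[μ] ℝ) x ∂μ = 0 := by
      apply integral_eq_zero_of_ae
      filter_upwards [Linfty.coe_zero_ae (μ := μ)] with x hx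
      rw [map_zero, hx, mul_zero]
      rfl
    rw [h0] at hw
    have := ge_of_tendsto' hw hFc
    exact absurd this (not_le.2 (mul_pos hη (ENNReal.toReal_pos hc0.ne' hctop)))
  · refine (div_le_one (by positivity)).2 ?_ |>.trans (by norm_num)
    linarith [(Nat.cast_nonneg m : (0 : ℝ) ≤ m)]
  · exact squeeze_zero_norm (fun m => hFb m x) tendsto_one_div_add_atTop_nhds_zero_nat

end Euclidean

/-! ### Linear independence over L^∞ and at almost every point. -/

/-- If the rows of a matrix are linearly independent, then no nonzero scalar annihilates all its
maximal minors (McCoy). -/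
theorem Matrix.exists_mul_det_submatrix_ne_zero {R ι : Type*} [CommRing R] {c : R} (hc : c ≠ 0) :
    ∀ {k : ℕ} (A : Matrix (Fin k) ι R),
      (∀ w : Fin k → R, (∀ j, ∑ i, w i * A i j = 0) → w = 0) →
      ∃ s : Fin k → ι, c * (A.submatrix id s).det ≠ 0
  | 0, A, _ => ⟨Fin.elim0, by simpa using hc⟩
  | k + 1, A, h => by
    obtain ⟨s, hs⟩ := Matrix.exists_mul_det_submatrix_ne_zero hc (A.submatrix Fin.succ id)
      fun w hw => by
        have h1 := h (Fin.cons 0 w) fun j => by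
          rw [Fin.sum_univ_succ]
          simpa using hw j
        funext i
        simpa using congrFun h1 i.succ
    by_contra hall
    push Not at hall
    -- If c kills every maximal minor, expansion along a prepended column j shows that c times the
    -- signed cofactors is a relation among the rows. Its entry at 0 is c times the minor found by
    -- induction, which is nonzero.
    have h2 := h (fun i => c * ((-1) ^ (i : ℕ) * (A.submatrix i.succAbove s).det)) fun j => by
      have h3 := hall (Fin.cons j s)
      rw [Matrix.det_succ_column_zero, Finset.mul_sum] at h3
      rw [← h3]
      refine Finset.sum_congr rfl fun i _ => ?_
      have e : (A.submatrix id (Fin.cons j s : Fin (k + 1) → ι)).submatrix i.succAbove Fin.succ =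
          A.submatrix i.succAbove s := by
        ext a b
        simp
      rw [e]
      simp only [Matrix.submatrix_apply, id, Fin.cons_zero]
      ring
    have h3 := congrFun h2 0
    simp only [Fin.val_zero, pow_zero, one_mul, Pi.zero_apply] at h3
    refine hs ?_
    rw [← h3]
    rfl

/-- For a square matrix, every choice of columns, with repetitions allowed, has determinant a
multiple of `A.det`; McCoy's theorem then makes `A.det` a non-zero-divisor. -/
theorem Matrix.mul_det_ne_zero_of_rows {R : Type*} [CommRing R] {k : ℕ}
    (A : Matrix (Fin k) (Fin k) R)
    (h : ∀ w : Fin k → R, (∀ j, ∑ i, w i * A i j = 0) → w = 0) {c : R} (hc : c ≠ 0) :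
    c * A.det ≠ 0 := by
  obtain ⟨s, hs⟩ := Matrix.exists_mul_det_submatrix_ne_zero hc A h
  intro h0
  refine hs ?_
  have e : A.submatrix id s = A * (1 : Matrix (Fin k) (Fin k) R).submatrix id s := by
    ext i j
    simp [Matrix.mul_apply, Matrix.one_apply]
  rw [e, Matrix.det_mul, ← mul_assoc, h0, zero_mul]

/-- The indicator of the zero set annihilates u, so it must be the zero class. -/
theorem Linfty.ae_ne_zero_of_mul_ne_zero {X : Type*} [MeasurableSpace X] {μ : Measure X}
    (u : Linfty μ) (h : ∀ v : Linfty μ, v ≠ 0 → v * u ≠ 0) :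
    ∀ᵐ x ∂μ, (u : X →ₘ[μ] ℝ) x ≠ 0 := by
  have hS : MeasurableSet {x | (u : X →ₘ[μ] ℝ) x = 0} :=
    (u : X →ₘ[μ] ℝ).measurable (measurableSet_singleton 0)
  let v : Linfty μ := Linfty.ofBounded ({x | (u : X →ₘ[μ] ℝ) x = 0}.indicator fun _ => (1 : ℝ))
    (stronglyMeasurable_const.indicator hS).aestronglyMeasurable
    ⟨1, Eventually.of_forall fun x => by
      by_cases hx : (u : X →ₘ[μ] ℝ) x = 0 <;> simp [hx]⟩
  have hv : ∀ᵐ x ∂μ, (v : X →ₘ[μ] ℝ) x =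
      {x | (u : X →ₘ[μ] ℝ) x = 0}.indicator (fun _ => (1 : ℝ)) x := Linfty.coe_ofBounded_ae _ _ _
  have h0 : v * u = 0 := by
    apply Linfty.ext_ae
    filter_upwards [hv, Linfty.coe_mul_ae v u, Linfty.coe_zero_ae (μ := μ)] with x h1 h2 h3
    rw [h2, h1, h3]
    by_cases hx : (u : X →ₘ[μ] ℝ) x = 0 <;> simp [hx]
  have hv0 : v = 0 := by
    by_contra hne
    exact h v hne h0
  rw [hv0] at hv
  filter_upwards [hv, Linfty.coe_zero_ae (μ := μ)] with x h1 h2 hx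
  rw [h2] at h1
  simp [hx] at h1

theorem Linfty.nontrivial_of_ne_zero {X : Type*} [MeasurableSpace X] {μ : Measure X} (hμ : μ ≠ 0) :
    Nontrivial (Linfty μ) := by
  refine ⟨⟨0, 1, fun h => hμ ?_⟩⟩
  have h1 : ∀ᵐ x ∂μ, ((1 : Linfty μ) : X →ₘ[μ] ℝ) x = 1 := AEEqFun.coeFn_one
  rw [← h] at h1
  have h2 : ∀ᵐ x ∂μ, False := by
    filter_upwards [h1, Linfty.coe_zero_ae (μ := μ)] with x h1 h2
    rw [h2] at h1
    exact zero_ne_one h1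
  simpa using h2

instance DerivationModule.instAddCommGroup {X : Type*} [MetricSpace X] [MeasurableSpace X]
    [BorelSpace X] (μ : Measure X) : AddCommGroup (DerivationModule μ) :=
  Submodule.addCommGroup _

instance DerivationModule.instModule {X : Type*} [MetricSpace X] [MeasurableSpace X]
    [BorelSpace X] (μ : Measure X) : Module (Linfty μ) (DerivationModule μ) :=
  Submodule.module _

theorem DerivationModule.coe_sum_smul_apply {X : Type*} [MetricSpace X] [MeasurableSpace X]
    [BorelSpace X] {μ : Measure X} {ι : Type*} (s : Finset ι) (w : ι → Linfty μ)
    (δ : ι → DerivationModule μ) (f : LipB X) :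
    (∑ i ∈ s, w i • δ i : DerivationModule μ).1 f = ∑ i ∈ s, w i * (δ i).1 f := by
  classical
  induction s using Finset.induction_on with
  | empty => rfl
  | insert a s ha ih =>
    rw [Finset.sum_insert ha, Finset.sum_insert ha, ← ih]
    rfl

section Euclidean

variable {n : ℕ} {μ : Measure (EuclideanSpace ℝ (Fin n))}

/-- The vector fields of `n` linearly independent derivations span `ℝⁿ` almost everywhere. -/
theorem ae_eq_zero_of_sum_derivationComponent_eq_zero [SigmaFinite μ]
    {δ : Fin n → DerivationModule μ} (hδ : LinearIndependent (Linfty μ) δ) :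
    ∀ᵐ a ∂μ, ∀ z : Fin n → ℝ,
      (∀ i, ∑ j, derivationComponent (δ i).1 j a * z j = 0) → z = 0 := by
  let A : Matrix (Fin n) (Fin n) (Linfty μ) := fun i j =>
    (δ i).1 (boundedCoord j)
  -- A relation among the rows is a combination of the δ i that kills every bounded coordinate,
  -- hence the zero derivation.
  have hA : ∀ w : Fin n → Linfty μ, (∀ j, ∑ i, w i * A i j = 0) → w = 0 := by
    intro w hw
    funext i
    refine Fintype.linearIndependent_iff.1 hδ w (Subtype.ext ?_) i
    refine IsMetricDerivation.eq_zero_of_boundedCoord (∑ i, w i • δ i).2 fun j => ?_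
    exact (DerivationModule.coe_sum_smul_apply _ _ _ _).trans (hw j)
  have hdet := Linfty.ae_ne_zero_of_mul_ne_zero A.det fun v hv =>
    Matrix.mul_det_ne_zero_of_rows A hA hv
  -- Evaluating the adjugate identity entrywise gives an inverse up to the factor det A at almost
  -- every point, without evaluating a determinant pointwise.
  have hadj : ∀ᵐ a ∂μ, ∀ k j, ∑ i, (A.adjugate k i : EuclideanSpace ℝ (Fin n) →ₘ[μ] ℝ) a *
      (A i j : EuclideanSpace ℝ (Fin n) →ₘ[μ] ℝ) a =
      if k = j then (A.det : EuclideanSpace ℝ (Fin n) →ₘ[μ] ℝ) a else 0 := by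
    refine ae_all_iff.2 fun k => ae_all_iff.2 fun j => ?_
    have h1 : ∑ i, A.adjugate k i * A i j = if k = j then A.det else 0 := by
      rw [← Matrix.mul_apply, Matrix.adjugate_mul, Matrix.smul_apply, Matrix.one_apply]
      split_ifs <;> simp
    filter_upwards [Linfty.coe_sum_ae Finset.univ (fun i => A.adjugate k i * A i j),
      ae_all_iff.2 fun i => Linfty.coe_mul_ae (A.adjugate k i) (A i j),
      Linfty.coe_zero_ae (μ := μ)] with a h2 h3 h4
    rw [h1, Finset.sum_congr rfl fun i _ => h3 i] at h2
    rw [← h2]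
    split_ifs
    · rfl
    · exact h4
  filter_upwards [hdet, hadj] with a h1 h2 z hz
  funext k
  have h3 : ∑ i, (A.adjugate k i : EuclideanSpace ℝ (Fin n) →ₘ[μ] ℝ) a *
      ∑ j, derivationComponent (δ i).1 j a * z j = 0 :=
    Finset.sum_eq_zero fun i _ => by rw [hz i, mul_zero]
  have h4 : ∑ i, (A.adjugate k i : EuclideanSpace ℝ (Fin n) →ₘ[μ] ℝ) a *
      ∑ j, derivationComponent (δ i).1 j a * z j =
      ∑ j, (∑ i, (A.adjugate k i : EuclideanSpace ℝ (Fin n) →ₘ[μ] ℝ) a *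
        (A i j : EuclideanSpace ℝ (Fin n) →ₘ[μ] ℝ) a) * ((1 + a j ^ 2) * z j) := by
    simp only [Finset.mul_sum, Finset.sum_mul]
    rw [Finset.sum_comm]
    refine Finset.sum_congr rfl fun j _ => Finset.sum_congr rfl fun i _ => ?_
    simp only [derivationComponent, A]
    ring
  rw [h3] at h4
  simp only [h2, ite_mul, zero_mul, Finset.sum_ite_eq, Finset.mem_univ, if_true] at h4
  have h5 : (1 + a k ^ 2) ≠ 0 := by positivity
  rcases mul_eq_zero.1 h4.symm with h | h
  · exact absurd h h1
  · exact (mul_eq_zero.1 h).resolve_left h5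

/-- Evaluation on the n bounded coordinates embeds the module linearly in a free module of rank n.
-/
theorem derivationRank_le [SigmaFinite μ] (hμ : μ ≠ 0) : derivationRank μ ≤ n := by
  have := Linfty.nontrivial_of_ne_zero hμ
  let L : DerivationModule μ →ₗ[Linfty μ] (Fin n → Linfty μ) :=
    { toFun := fun δ j => δ.1 (boundedCoord j)
      map_add' := fun _ _ => rfl
      map_smul' := fun _ _ => rfl }
  have hL : Function.Injective L := by
    refine fun δ ε h => sub_eq_zero.1 (Subtype.ext ?_)
    exact IsMetricDerivation.eq_zero_of_boundedCoord (δ - ε).2 fun j =>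
      sub_eq_zero.2 (congrFun h j)
  have h := L.rank_le_of_injective hL
  rwa [rank_fin_fun] at h

end Euclidean

/-! ### Haar measures: directional derivatives as derivations. -/

section Haar

variable {n : ℕ} {ν : Measure (EuclideanSpace ℝ (Fin n))}

theorem LipB.exists_lipschitzWith {X : Type*} [MetricSpace X] (f : LipB X) :
    ∃ K : ℝ≥0, LipschitzWith K (f : X → ℝ) := f.2.1

theorem abs_lineDeriv_le {f : EuclideanSpace ℝ (Fin n) → ℝ} {K : ℝ≥0} (hf : LipschitzWith K f)
    (v : EuclideanSpace ℝ (Fin n)) : ∀ x, |lineDeriv ℝ f x v| ≤ K * ‖v‖ :=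
  fun _ => norm_lineDeriv_le_of_lipschitz ℝ hf

/-- The class of the directional derivative of a bounded Lipschitz function. -/
def lineDerivLinfty (ν : Measure (EuclideanSpace ℝ (Fin n))) (v : EuclideanSpace ℝ (Fin n))
    (f : LipB (EuclideanSpace ℝ (Fin n))) : Linfty ν :=
  Linfty.ofBounded (fun x => lineDeriv ℝ (f : EuclideanSpace ℝ (Fin n) → ℝ) x v)
    (aestronglyMeasurable_lineDeriv (LipB.continuous f) ν)
    ⟨(LipB.exists_lipschitzWith f).choose * ‖v‖, Eventually.of_forall
      (abs_lineDeriv_le (LipB.exists_lipschitzWith f).choose_spec v)⟩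

theorem coe_lineDerivLinfty_ae (v : EuclideanSpace ℝ (Fin n))
    (f : LipB (EuclideanSpace ℝ (Fin n))) :
    ∀ᵐ x ∂ν, (lineDerivLinfty ν v f : EuclideanSpace ℝ (Fin n) →ₘ[ν] ℝ) x =
      lineDeriv ℝ (f : EuclideanSpace ℝ (Fin n) → ℝ) x v :=
  Linfty.coe_ofBounded_ae _ _ _

theorem LipB.ae_lineDifferentiableAt [ν.IsAddHaarMeasure] (f : LipB (EuclideanSpace ℝ (Fin n)))
    (v : EuclideanSpace ℝ (Fin n)) :
    ∀ᵐ x ∂ν, LineDifferentiableAt ℝ (f : EuclideanSpace ℝ (Fin n) → ℝ) x v := by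
  obtain ⟨K, hK⟩ := LipB.exists_lipschitzWith f
  exact hK.ae_lineDifferentiableAt v

/-- The directional derivative as a linear operator on bounded Lipschitz functions. -/
def directionalDerivation (ν : Measure (EuclideanSpace ℝ (Fin n))) [ν.IsAddHaarMeasure]
    (v : EuclideanSpace ℝ (Fin n)) : LipB (EuclideanSpace ℝ (Fin n)) →ₗ[ℝ] Linfty ν where
  toFun := lineDerivLinfty ν v
  map_add' f g := by
    apply Linfty.ext_ae
    filter_upwards [coe_lineDerivLinfty_ae (ν := ν) v f, coe_lineDerivLinfty_ae (ν := ν) v g,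
      coe_lineDerivLinfty_ae (ν := ν) v (f + g), LipB.ae_lineDifferentiableAt (ν := ν) f v,
      LipB.ae_lineDifferentiableAt (ν := ν) g v,
      Linfty.coe_add_ae (lineDerivLinfty ν v f) (lineDerivLinfty ν v g)] with x h1 h2 h3 h4 h5 h6
    rw [h6, h1, h2, h3]
    have h : HasLineDerivAt ℝ ((f + g : LipB _) : EuclideanSpace ℝ (Fin n) → ℝ) _ x v :=
      HasDerivAt.add h4.hasLineDerivAt h5.hasLineDerivAt
    exact h.lineDeriv
  map_smul' c f := by
    apply Linfty.ext_ae
    filter_upwards [coe_lineDerivLinfty_ae (ν := ν) v f, coe_lineDerivLinfty_ae (ν := ν) v (c • f),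
      LipB.ae_lineDifferentiableAt (ν := ν) f v,
      Linfty.coe_smul_ae c (lineDerivLinfty ν v f)] with x h1 h2 h3 h4
    rw [RingHom.id_apply, h4, h1, h2]
    have h : HasLineDerivAt ℝ ((c • f : LipB _) : EuclideanSpace ℝ (Fin n) → ℝ) _ x v :=
      HasDerivAt.const_smul c h3.hasLineDerivAt
    exact h.lineDeriv

theorem coe_directionalDerivation_ae [ν.IsAddHaarMeasure] (v : EuclideanSpace ℝ (Fin n))
    (f : LipB (EuclideanSpace ℝ (Fin n))) :
    ∀ᵐ x ∂ν, (directionalDerivation ν v f : EuclideanSpace ℝ (Fin n) →ₘ[ν] ℝ) x =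
      lineDeriv ℝ (f : EuclideanSpace ℝ (Fin n) → ℝ) x v :=
  coe_lineDerivLinfty_ae v f

theorem MeasureTheory.Integrable.exists_contDiff_hasCompactSupport [IsLocallyFiniteMeasure ν]
    {h : EuclideanSpace ℝ (Fin n) → ℝ} (hh : Integrable h ν) {ε : ℝ} (hε : 0 < ε) :
    ∃ g : EuclideanSpace ℝ (Fin n) → ℝ, ContDiff ℝ 1 g ∧ HasCompactSupport g ∧
      Integrable g ν ∧ ∫ x, ‖h x - g x‖ ∂ν ≤ ε := by
  obtain ⟨g, hg, hgd, hgh⟩ := (memLp_one_iff_integrable.2 hh).exist_eLpNorm_sub_le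
    ENNReal.one_ne_top le_rfl hε
  have hgi : Integrable g ν := hgd.continuous.integrable_of_hasCompactSupport hg
  refine ⟨g, hgd.of_le (by simp), hg, hgi, ?_⟩
  rw [integral_norm_eq_lintegral_enorm (f := fun x => h x - g x)
    (hh.sub hgi).aestronglyMeasurable]
  rw [eLpNorm_one_eq_lintegral_enorm] at hgh
  exact ENNReal.toReal_le_of_le_ofReal hε.le hgh

/-- The bound and the product rule come from Lipschitz bounds and Rademacher's theorem along lines.
For weak-star continuity, integration by parts moves the derivative onto a C¹_c test function, where
dominated convergence applies; density of such functions in L¹ and the uniform bound on the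
derivatives do the rest. -/
theorem isMetricDerivation_directionalDerivation [ν.IsAddHaarMeasure]
    (v : EuclideanSpace ℝ (Fin n)) : IsMetricDerivation ν (directionalDerivation ν v) where
  bounded := ⟨‖v‖, fun f K hf => by
    filter_upwards [coe_directionalDerivation_ae (ν := ν) v f] with x hx
    rw [hx, mul_comm]
    exact abs_lineDeriv_le hf.1 v x⟩
  leibniz f g := by
    apply Linfty.ext_ae
    filter_upwards [coe_directionalDerivation_ae (ν := ν) v f,
      coe_directionalDerivation_ae (ν := ν) v g,
      coe_directionalDerivation_ae (ν := ν) v (f * g), LipB.ae_lineDifferentiableAt (ν := ν) f v,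
      LipB.ae_lineDifferentiableAt (ν := ν) g v,
      Linfty.coe_add_ae (LipB.toLinfty ν f * directionalDerivation ν v g)
        (LipB.toLinfty ν g * directionalDerivation ν v f),
      Linfty.coe_mul_ae (LipB.toLinfty ν f) (directionalDerivation ν v g),
      Linfty.coe_mul_ae (LipB.toLinfty ν g) (directionalDerivation ν v f),
      LipB.coe_toLinfty_ae (μ := ν) f, LipB.coe_toLinfty_ae (μ := ν) g]
      with x h1 h2 h3 h4 h5 h6 h7 h8 h9 h10
    rw [h6, h7, h8, h9, h10, h1, h2, h3]
    have h : HasLineDerivAt ℝ ((f * g : LipB _) : EuclideanSpace ℝ (Fin n) → ℝ) _ x v :=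
      HasDerivAt.mul h4.hasLineDerivAt h5.hasLineDerivAt
    rw [h.lineDeriv]
    simp only [zero_smul, add_zero]
    ring
  weakContinuous F f hF hlim h hh := by
    obtain ⟨K, hK⟩ := hF
    have hfK : LipschitzWith K (f : EuclideanSpace ℝ (Fin n) → ℝ) := by
      refine LipschitzWith.of_dist_le_mul fun x y => ?_
      exact le_of_tendsto' ((hlim x).dist (hlim y)) fun m => (hK m).1.dist_le_mul x y
    have key : ∀ g : EuclideanSpace ℝ (Fin n) → ℝ, ContDiff ℝ 1 g → HasCompactSupport g →
        Tendsto (fun m => ∫ x, g x * lineDeriv ℝ (F m : EuclideanSpace ℝ (Fin n) → ℝ) x v ∂ν)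
          atTop (𝓝 (∫ x, g x * lineDeriv ℝ (f : EuclideanSpace ℝ (Fin n) → ℝ) x v ∂ν)) := by
      intro g hgd hg
      obtain ⟨D, hD⟩ := hgd.lipschitzWith_of_hasCompactSupport hg one_ne_zero
      have e : ∀ (q : EuclideanSpace ℝ (Fin n) → ℝ), LipschitzWith K q →
          ∫ x, g x * lineDeriv ℝ q x v ∂ν = ∫ x, lineDeriv ℝ g x (-v) * q x ∂ν := fun q hq => by
        rw [← hq.integral_lineDeriv_mul_eq hD hg v]
        exact integral_congr_ae (Eventually.of_forall fun x => mul_comm _ _)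
      rw [e _ hfK]
      simp only [fun m => e _ (hK m).1]
      have hgi : Integrable (fun x => lineDeriv ℝ g x (-v)) ν := by
        have e1 : (fun x => lineDeriv ℝ g x (-v)) = fun x => fderiv ℝ g x (-v) := funext fun x =>
          (hgd.differentiable one_ne_zero x).lineDeriv_eq_fderiv
        rw [e1]
        exact ((hgd.continuous_fderiv one_ne_zero).clm_apply continuous_const
          ).integrable_of_hasCompactSupport (hg.fderiv_apply ℝ (-v))
      refine tendsto_integral_of_dominated_convergence (fun x => ‖lineDeriv ℝ g x (-v)‖ * K)
        (fun m => hgi.aestronglyMeasurable.mul (LipB.continuous (F m)).aestronglyMeasurable)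
        (hgi.norm.mul_const _) (fun m => Eventually.of_forall fun x => ?_)
        (Eventually.of_forall fun x => (hlim x).const_mul _)
      rw [norm_mul]
      exact mul_le_mul_of_nonneg_left ((hK m).2 x) (norm_nonneg _)
    have e : ∀ q : LipB (EuclideanSpace ℝ (Fin n)),
        ∫ x, h x * (directionalDerivation ν v q : EuclideanSpace ℝ (Fin n) →ₘ[ν] ℝ) x ∂ν =
        ∫ x, h x * lineDeriv ℝ (q : EuclideanSpace ℝ (Fin n) → ℝ) x v ∂ν := fun q => by
      refine integral_congr_ae ?_
      filter_upwards [coe_directionalDerivation_ae (ν := ν) v q] with x hx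
      rw [hx]
    simp only [e]
    rw [Metric.tendsto_atTop]
    intro ε hε
    -- B bounds all the directional derivatives involved; the added 1 keeps it positive. Replacing h
    -- by g then costs ε/4 at each end.
    let B : ℝ := K * ‖v‖ + 1
    have hB : 0 < B := by positivity
    obtain ⟨g, hgd, hgc, hgi, hgh⟩ := hh.exists_contDiff_hasCompactSupport
      (ε := ε / (4 * B)) (by positivity)
    obtain ⟨N, hN⟩ := Metric.tendsto_atTop.1 (key g hgd hgc) (ε / 4) (by positivity)
    have hclose : ∀ q : LipB (EuclideanSpace ℝ (Fin n)),
        LipschitzWith K (q : EuclideanSpace ℝ (Fin n) → ℝ) →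
        |∫ x, h x * lineDeriv ℝ (q : EuclideanSpace ℝ (Fin n) → ℝ) x v ∂ν -
          ∫ x, g x * lineDeriv ℝ (q : EuclideanSpace ℝ (Fin n) → ℝ) x v ∂ν| ≤ ε / 4 := by
      intro q hq
      have hi : ∀ w : EuclideanSpace ℝ (Fin n) → ℝ, Integrable w ν → Integrable
          (fun x => w x * lineDeriv ℝ (q : EuclideanSpace ℝ (Fin n) → ℝ) x v) ν := fun w hw =>
        hw.mul_bdd (c := K * ‖v‖) (aestronglyMeasurable_lineDeriv (LipB.continuous q) ν)
          (Eventually.of_forall (abs_lineDeriv_le hq v))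
      rw [← integral_sub (hi h hh) (hi g hgi)]
      have h1 := norm_integral_le_of_norm_le (μ := ν)
        (f := fun x => h x * lineDeriv ℝ (q : EuclideanSpace ℝ (Fin n) → ℝ) x v -
          g x * lineDeriv ℝ (q : EuclideanSpace ℝ (Fin n) → ℝ) x v)
        ((hh.sub hgi).norm.mul_const B) (Eventually.of_forall fun x => by
          rw [← sub_mul, norm_mul]
          exact mul_le_mul_of_nonneg_left ((abs_lineDeriv_le hq v x).trans
            (by simp [B])) (norm_nonneg _))
      rw [integral_mul_const] at h1
      refine h1.trans ?_
      calc _ ≤ ε / (4 * B) * B := mul_le_mul_of_nonneg_right hgh hB.le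
        _ = ε / 4 := by field_simp
    refine ⟨N, fun m hm => ?_⟩
    have h1 := abs_le.1 (hclose (F m) (hK m).1)
    have h2 := abs_le.1 (hclose f hfK)
    have h3 := hN m hm
    rw [Real.dist_eq, abs_lt] at h3 ⊢
    constructor <;> linarith

/-- The coordinate derivatives act on the bounded coordinates by a diagonal matrix with nowhere
vanishing diagonal. -/
theorem le_derivationRank_of_isAddHaarMeasure [ν.IsAddHaarMeasure] :
    (n : Cardinal) ≤ derivationRank ν := by
  have : Nontrivial (Linfty ν) := Linfty.nontrivial_of_ne_zero (NeZero.ne ν)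
  let δ : Fin n → DerivationModule ν := fun i =>
    ⟨directionalDerivation ν (EuclideanSpace.single i 1),
      isMetricDerivation_directionalDerivation _⟩
  have hδ : LinearIndependent (Linfty ν) δ := by
    rw [Fintype.linearIndependent_iff]
    intro w hw j
    have h1 : ∑ i, w i * directionalDerivation ν (EuclideanSpace.single i 1) (boundedCoord j)
        = 0 := by
      have := congrArg (fun d : DerivationModule ν =>
        (d : LipB _ →ₗ[ℝ] Linfty ν) (boundedCoord j)) hw
      simpa [δ, LinearMap.sum_apply] using this
    apply Linfty.ext_ae
    filter_upwards [Linfty.coe_sum_ae (μ := ν) Finset.univ (fun i => w i *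
        directionalDerivation ν (EuclideanSpace.single i 1) (boundedCoord j)),
      ae_all_iff.2 fun i => Linfty.coe_mul_ae (w i)
        (directionalDerivation ν (EuclideanSpace.single i 1) (boundedCoord j)),
      ae_all_iff.2 fun i => coe_directionalDerivation_ae (ν := ν) (EuclideanSpace.single i 1)
        (boundedCoord j), Linfty.coe_zero_ae (μ := ν)] with x h2 h3 h4 h5
    have h6 : ∀ i, lineDeriv ℝ (boundedCoord j : EuclideanSpace ℝ (Fin n) → ℝ) x
        (EuclideanSpace.single i 1) = if i = j then 1 / (1 + x j ^ 2) else 0 := fun i => by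
      rw [((hasStrictFDerivAt_boundedCoord j x).hasFDerivAt.hasLineDerivAt _).lineDeriv]
      have e : (EuclideanSpace.proj j : EuclideanSpace ℝ (Fin n) →L[ℝ] ℝ)
        (EuclideanSpace.single i 1) = if i = j then 1 else 0 := by
        change (EuclideanSpace.single i (1 : ℝ) : EuclideanSpace ℝ (Fin n)) j = _
        simp [eq_comm]
      rw [smul_apply, e]
      simp
    rw [h1, h5] at h2
    simp only [h3, h4, h6, mul_ite, mul_zero, Finset.sum_ite_eq', Finset.mem_univ, if_true] at h2
    have h7 : (1 / (1 + x j ^ 2)) ≠ 0 := by positivity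
    rw [h5]
    exact (mul_eq_zero.1 h2.symm).resolve_right h7
  simpa [derivationRank] using hδ.cardinal_le_rank

end Haar

/-! ### Freezing the coefficients and blowing up. -/

section Euclidean

variable {n : ℕ} {μ : Measure (EuclideanSpace ℝ (Fin n))}

theorem abs_partialDeriv_le {f : EuclideanSpace ℝ (Fin n) → ℝ} {K : ℝ≥0} (hf : LipschitzWith K f)
    (j : Fin n) (x : EuclideanSpace ℝ (Fin n)) : |partialDeriv f j x| ≤ K := by
  have h := (fderiv ℝ f x).le_of_opNorm_le (norm_fderiv_le_of_lipschitz ℝ hf)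
    (EuclideanSpace.single j 1)
  simpa [partialDeriv] using h

theorem continuous_partialDeriv {f : EuclideanSpace ℝ (Fin n) → ℝ} (hf : ContDiff ℝ 1 f)
    (j : Fin n) : Continuous (partialDeriv f j) :=
  (hf.continuous_fderiv one_ne_zero).clm_apply continuous_const

theorem partialDeriv_eq_zero {f : EuclideanSpace ℝ (Fin n) → ℝ} {a : EuclideanSpace ℝ (Fin n)}
    {ρ : ℝ} (hf : ∀ x ∉ Metric.closedBall a ρ, f x = 0) (j : Fin n) :
    ∀ x ∉ Metric.closedBall a ρ, partialDeriv f j x = 0 := by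
  intro x hx
  have h : f =ᶠ[𝓝 x] fun _ => 0 := by
    filter_upwards [Metric.isClosed_closedBall.isOpen_compl.mem_nhds hx] with y hy
    exact hf y hy
  rw [partialDeriv, h.fderiv_eq]
  simp

theorem locallyIntegrable_derivationComponent [IsLocallyFiniteMeasure μ]
    (d : LipB (EuclideanSpace ℝ (Fin n)) →ₗ[ℝ] Linfty μ) (j : Fin n) :
    LocallyIntegrable (derivationComponent d j) μ := by
  obtain ⟨C, hC⟩ := (d (boundedCoord j)).2
  have h1 : LocallyIntegrable
      (fun x => (d (boundedCoord j) : EuclideanSpace ℝ (Fin n) →ₘ[μ] ℝ) x) μ :=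
    (memLp_top_of_bound (d (boundedCoord j) : EuclideanSpace ℝ (Fin n) →ₘ[μ] ℝ).aestronglyMeasurable
      C hC).locallyIntegrable le_top
  have h2 := (locallyIntegrableOn_univ.2 h1).continuousOn_mul
    (g := fun x : EuclideanSpace ℝ (Fin n) => 1 + x j ^ 2) (Continuous.continuousOn
      (continuous_const.add ((EuclideanSpace.lipschitzWith_apply j).continuous.pow 2)))
    isOpen_univ.isLocallyClosed
  exact locallyIntegrableOn_univ.1 h2

/-- At almost every point `a`, the divergence of the constant vector field obtained by freezing a
derivation at `a` is negligible at small scales. -/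
theorem IsMetricDerivation.ae_eventually_integral_partialDeriv_le [IsLocallyFiniteMeasure μ]
    {d : LipB (EuclideanSpace ℝ (Fin n)) →ₗ[ℝ] Linfty μ} (hd : IsMetricDerivation μ d)
    {η : ℝ} (hη : 0 < η) :
    ∀ᵐ a ∂μ, ∃ ρ₀ > 0, ∀ ρ ∈ Set.Ioo 0 ρ₀, ∀ f : EuclideanSpace ℝ (Fin n) → ℝ,
      ContDiff ℝ 1 f → IsBallTest a ρ f →
      ∫ x, ∑ j, partialDeriv f j x * derivationComponent d j a ∂μ ≤
        η * μ.real (Metric.closedBall a ρ) := by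
  -- The divergence estimate needs an integrable weight, and the constant 1 need not be integrable.
  -- The indicator of a large ball equals 1 on all the balls B(a, ρ) with ρ < 1 once N ≥ ‖a‖ + 1.
  have hball : ∀ N : ℕ, Integrable ((Metric.closedBall (0 : EuclideanSpace ℝ (Fin n)) N).indicator
      fun _ => (1 : ℝ)) μ := fun N =>
    (integrable_indicator_iff measurableSet_closedBall).2
      (integrableOn_const measure_closedBall_lt_top.ne)
  have h1 := ae_all_iff.2 fun N : ℕ => hd.ae_eventually_integral_le (hball N) (half_pos hη)
  have h2 := ae_all_iff.2 fun j => (Besicovitch.vitaliFamily μ).ae_tendsto_average_norm_sub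
    (locallyIntegrable_derivationComponent d j)
  filter_upwards [h1, h2] with a ha1 ha2
  -- The n oscillation terms then total at most η/2 times the measure of the ball, leaving η/2 for
  -- the divergence estimate.
  let θ : ℝ := η / (2 * ((n : ℝ) + 1))
  have hθ : 0 < θ := by positivity
  obtain ⟨N, hN⟩ := exists_nat_ge (‖a‖ + 1)
  obtain ⟨ρ₁, hρ₁, hB⟩ := ha1 N
  have h3 : ∀ᶠ r in 𝓝[>] (0 : ℝ), ∀ j, ⨍ y in Metric.closedBall a r,
      ‖derivationComponent d j y - derivationComponent d j a‖ ∂μ < θ := by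
    rw [eventually_all]
    exact fun j => ((ha2 j).comp (Besicovitch.tendsto_filterAt μ a)).eventually_lt_const hθ
  obtain ⟨ρ₂, hρ₂, havg⟩ := mem_nhdsGT_iff_exists_Ioo_subset.1 h3
  refine ⟨min ρ₁ (min ρ₂ 1), lt_min hρ₁ (lt_min hρ₂ one_pos), fun ρ hρ f hf hfB => ?_⟩
  obtain ⟨hρ0, hρlt⟩ := hρ
  obtain ⟨hlt1, hlt2, hlt3⟩ : ρ < ρ₁ ∧ ρ < ρ₂ ∧ ρ < 1 := by simpa using hρlt
  set B := Metric.closedBall a ρ with hBdef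
  have hBfin : μ B ≠ ⊤ := measure_closedBall_lt_top.ne
  let F : LipB (EuclideanSpace ℝ (Fin n)) := LipB.of f hfB.1 hfB.2.1
  have hF := hB ρ ⟨hρ0, hlt1⟩ F hfB
  have hsub : B ⊆ Metric.closedBall (0 : EuclideanSpace ℝ (Fin n)) N := by
    intro x hx
    rw [mem_closedBall_zero_iff]
    have := norm_le_norm_add_norm_sub' x a
    rw [← dist_eq_norm] at this
    have := Metric.mem_closedBall.1 hx
    linarith
  have hosc : ∀ j, IntegrableOn
      (fun y => ‖derivationComponent d j y - derivationComponent d j a‖) B μ := fun j =>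
    (((locallyIntegrable_derivationComponent d j).integrableOn_isCompact
      (isCompact_closedBall a ρ)).sub (integrableOn_const hBfin)).norm
  have hoscle : ∀ j, ∫ y in B, ‖derivationComponent d j y - derivationComponent d j a‖ ∂μ ≤
      θ * μ.real B := fun j => by
    rw [← measure_smul_setAverage _ hBfin, smul_eq_mul, mul_comm]
    exact mul_le_mul_of_nonneg_right (havg ⟨hρ0, hlt2⟩ j).le measureReal_nonneg
  have hcont : Continuous fun x => ∑ j, partialDeriv f j x * derivationComponent d j a :=
    continuous_finsetSum _ fun j _ => (continuous_partialDeriv hf j).mul continuous_const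
  have hzero : ∀ x ∉ B, ∑ j, partialDeriv f j x * derivationComponent d j a = 0 := fun x hx =>
    Finset.sum_eq_zero fun j _ => by rw [partialDeriv_eq_zero hfB.2.2 j x hx, zero_mul]
  have hint1 : Integrable (fun x => ∑ j, partialDeriv f j x * derivationComponent d j a) μ :=
    hcont.integrable_of_hasCompactSupport
      (HasCompactSupport.intro (isCompact_closedBall a ρ) fun x hx => hzero x hx)
  have hint2 := Linfty.integrable_mul (d F) (hball N)
  have hint3 : Integrable (B.indicator fun y =>
      ∑ j, ‖derivationComponent d j y - derivationComponent d j a‖) μ :=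
    (integrable_indicator_iff measurableSet_closedBall).2
      (integrable_finsetSum _ fun j _ => hosc j)
  -- On the ball the frozen integrand differs from d F by partial derivatives, bounded by 1, times
  -- the oscillation of the components; off the ball both sides vanish.
  have hmono := integral_mono_ae hint1 (hint2.add hint3) (by
    filter_upwards [hd.ae_eq_sum_partialDeriv F hf] with x hx
    change _ ≤ (Metric.closedBall (0 : EuclideanSpace ℝ (Fin n)) N).indicator (fun _ => (1 : ℝ)) x *
      (d F : EuclideanSpace ℝ (Fin n) →ₘ[μ] ℝ) x + _
    by_cases hxB : x ∈ B
    · rw [Set.indicator_of_mem (hsub hxB), Set.indicator_of_mem hxB, one_mul, hx,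
        ← Finset.sum_add_distrib]
      refine Finset.sum_le_sum fun j _ => ?_
      have h4 : |partialDeriv f j x| ≤ 1 := by simpa using abs_partialDeriv_le hfB.1 j x
      have h5 := abs_mul (partialDeriv f j x)
        (derivationComponent d j x - derivationComponent d j a)
      have h6 := neg_abs_le (partialDeriv f j x *
        (derivationComponent d j x - derivationComponent d j a))
      have h7 := mul_le_of_le_one_left
        (abs_nonneg (derivationComponent d j x - derivationComponent d j a)) h4
      change _ ≤ partialDeriv f j x * _ + _
      rw [Real.norm_eq_abs]
      linarith
    · rw [hzero x hxB, Set.indicator_of_notMem hxB, hx,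
        Finset.sum_eq_zero fun j _ => by
          rw [show partialDeriv (F : EuclideanSpace ℝ (Fin n) → ℝ) j x = 0 from
            partialDeriv_eq_zero hfB.2.2 j x hxB, zero_mul]]
      simp)
  refine hmono.trans ?_
  have hadd := integral_add hint2 hint3
  refine hadd.le.trans ?_
  rw [integral_indicator measurableSet_closedBall, integral_finsetSum _ fun j _ => hosc j]
  have hs := Finset.sum_le_sum fun j (_ : j ∈ Finset.univ) => hoscle j
  rw [Finset.sum_const, Finset.card_univ, Fintype.card_fin, nsmul_eq_mul] at hs
  have h8 : (n : ℝ) * (θ * μ.real B) ≤ η / 2 * μ.real B := by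
    rw [← mul_assoc]
    refine mul_le_mul_of_nonneg_right ?_ measureReal_nonneg
    have : ((n : ℝ) + 1) * θ = η / 2 := by
      simp only [θ]
      field_simp
    linarith
  linarith

/-- Integration against the rescaled measures defining tangent measures. -/
theorem integral_ofReal_smul_map_rescale (a : EuclideanSpace ℝ (Fin n)) {c r : ℝ} (hc : 0 < c)
    {φ : EuclideanSpace ℝ (Fin n) → ℝ} (hφ : Continuous φ) :
    ∫ y, φ y ∂(ENNReal.ofReal c • μ.map (fun x => r⁻¹ • (x - a))) =
      c * ∫ x, φ (r⁻¹ • (x - a)) ∂μ := by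
  rw [integral_smul_measure, ENNReal.toReal_ofReal hc.le, smul_eq_mul, integral_map]
  · exact (by fun_prop : Continuous fun x : EuclideanSpace ℝ (Fin n) => r⁻¹ • (x - a)).aemeasurable
  · exact hφ.aestronglyMeasurable

theorem partialDeriv_rescale {φ : EuclideanSpace ℝ (Fin n) → ℝ} (hφ : Differentiable ℝ φ)
    (a : EuclideanSpace ℝ (Fin n)) {r : ℝ} (hr : r ≠ 0) (j : Fin n)
    (x : EuclideanSpace ℝ (Fin n)) :
    partialDeriv (fun x => r * φ (r⁻¹ • (x - a))) j x = partialDeriv φ j (r⁻¹ • (x - a)) := by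
  have h1 : HasFDerivAt (fun x : EuclideanSpace ℝ (Fin n) => r⁻¹ • (x - a))
      (r⁻¹ • ContinuousLinearMap.id ℝ (EuclideanSpace ℝ (Fin n))) x :=
    ((hasFDerivAt_id x).sub_const a).const_smul r⁻¹
  have h2 := ((hφ (r⁻¹ • (x - a))).hasFDerivAt.comp x h1).const_mul r
  rw [partialDeriv]
  have h3 : fderiv ℝ (fun x => r * φ (r⁻¹ • (x - a))) x = _ := h2.fderiv
  rw [h3]
  simp [partialDeriv, hr]

theorem IsBallTest.rescale {φ : EuclideanSpace ℝ (Fin n) → ℝ} {R : ℝ}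
    (hφ : IsBallTest 0 R φ) (a : EuclideanSpace ℝ (Fin n)) {r : ℝ} (hr : 0 < r) :
    IsBallTest a (r * R) (fun x => r * φ (r⁻¹ • (x - a))) := by
  refine ⟨LipschitzWith.of_dist_le_mul fun x y => ?_, fun x => ?_, fun x hx => ?_⟩
  · have h := hφ.1.dist_le_mul (r⁻¹ • (x - a)) (r⁻¹ • (y - a))
    rw [dist_smul₀, dist_sub_right, Real.norm_of_nonneg (inv_pos.2 hr).le] at h
    rw [Real.dist_eq] at h ⊢
    rw [← mul_sub, abs_mul, abs_of_pos hr]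
    calc _ ≤ r * ((1 : ℝ≥0) * (r⁻¹ * dist x y)) := mul_le_mul_of_nonneg_left h hr.le
      _ = _ := by field_simp
  · rw [abs_mul, abs_of_pos hr]
    exact mul_le_mul_of_nonneg_left (hφ.2.1 _) hr.le
  · refine mul_eq_zero_of_right _ (hφ.2.2 _ ?_)
    intro h
    apply hx
    rw [mem_closedBall_zero_iff, norm_smul, Real.norm_of_nonneg (inv_pos.2 hr).le,
      inv_mul_le_iff₀ hr] at h
    rwa [Metric.mem_closedBall, dist_eq_norm]

/-- The function x ↦ r φ((x − a)/r) is an admissible test on B(a, rR), and its partial derivatives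
are those of φ at the rescaled point. The factor 1/(k+1) in the estimate passes to the limit
measure, and then k tends to infinity. -/
theorem integral_partialDeriv_le_zero_of_isTangentMeasure [IsLocallyFiniteMeasure μ]
    {a : EuclideanSpace ℝ (Fin n)} {v : Fin n → ℝ}
    (hv : ∀ k : ℕ, ∃ ρ₀ > 0, ∀ ρ ∈ Set.Ioo 0 ρ₀, ∀ f : EuclideanSpace ℝ (Fin n) → ℝ,
      ContDiff ℝ 1 f → IsBallTest a ρ f →
      ∫ x, ∑ j, partialDeriv f j x * v j ∂μ ≤
        1 / ((k : ℝ) + 1) * μ.real (Metric.closedBall a ρ))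
    {ν : Measure (EuclideanSpace ℝ (Fin n))} (hν : IsTangentMeasure μ a ν)
    {φ : EuclideanSpace ℝ (Fin n) → ℝ} (hφ : ContDiff ℝ 1 φ) {R : ℝ} (hR : 0 < R)
    (hφR : IsBallTest 0 R φ) :
    ∫ y, ∑ j, partialDeriv φ j y * v j ∂ν ≤ 0 := by
  obtain ⟨-, -, c, r, hc, hr, -, hr0, hlim⟩ := hν
  have hcont : Continuous fun y => ∑ j, partialDeriv φ j y * v j :=
    continuous_finsetSum _ fun j _ => (continuous_partialDeriv hφ j).mul continuous_const
  let Φ : C_c(EuclideanSpace ℝ (Fin n), ℝ) := ⟨⟨_, hcont⟩,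
    HasCompactSupport.intro (isCompact_closedBall 0 R) fun x hx => by
      change ∑ j, partialDeriv φ j x * v j = 0
      exact Finset.sum_eq_zero fun j _ => by rw [partialDeriv_eq_zero hφR.2.2 j x hx, zero_mul]⟩
  -- The cutoff χ dominates the indicator of the ball of radius R, so the normalised masses of the
  -- balls B(a, r i · R) are bounded by integrals converging to ∫ χ dν; no doubling of μ is
  -- required.
  obtain ⟨χ, hχ1, -, hχc, hχ01⟩ := exists_continuous_one_zero_of_isCompact
    (isCompact_closedBall (0 : EuclideanSpace ℝ (Fin n)) R) isClosed_empty
    (Set.disjoint_empty _)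
  let X : C_c(EuclideanSpace ℝ (Fin n), ℝ) := ⟨χ, hχc⟩
  have hk : ∀ k : ℕ, ∫ y, Φ y ∂ν ≤ (∫ y, X y ∂ν) * (1 / ((k : ℝ) + 1)) := by
    intro k
    obtain ⟨ρ₀, hρ₀, hest⟩ := hv k
    refine le_of_tendsto_of_tendsto (hlim Φ) ((hlim X).mul_const _) ?_
    have hsmall : ∀ᶠ i in atTop, r i * R < ρ₀ := by
      have := hr0.mul_const R
      rw [zero_mul] at this
      exact this.eventually_lt_const hρ₀
    filter_upwards [hsmall] with i hi
    rw [integral_ofReal_smul_map_rescale a (hc i) (map_continuous Φ),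
      integral_ofReal_smul_map_rescale a (hc i) (map_continuous X), mul_assoc]
    refine mul_le_mul_of_nonneg_left ?_ (hc i).le
    have h1 := hest (r i * R) ⟨mul_pos (hr i) hR, hi⟩ _ (by fun_prop) (hφR.rescale a (hr i))
    simp only [partialDeriv_rescale (hφ.differentiable one_ne_zero) a (hr i).ne'] at h1
    refine h1.trans ?_
    rw [mul_comm]
    refine mul_le_mul_of_nonneg_right ?_ Nat.one_div_pos_of_nat.le
    have hXc : HasCompactSupport fun x => X ((r i)⁻¹ • (x - a)) :=
      hχc.comp_homeomorph ((Homeomorph.subRight a).trans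
        (Homeomorph.smulOfNeZero (r i)⁻¹ (inv_ne_zero (hr i).ne')))
    have hXi : Integrable (fun x => X ((r i)⁻¹ • (x - a))) μ :=
      ((map_continuous X).comp (by fun_prop)).integrable_of_hasCompactSupport hXc
    rw [← integral_indicator_one measurableSet_closedBall]
    refine integral_mono ((integrable_indicator_iff measurableSet_closedBall).2
      (integrableOn_const measure_closedBall_lt_top.ne)) hXi fun x => ?_
    by_cases hx : x ∈ Metric.closedBall a (r i * R)
    · rw [Set.indicator_of_mem hx]
      change (1 : ℝ) ≤ χ ((r i)⁻¹ • (x - a))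
      refine (hχ1 ?_).ge
      rw [mem_closedBall_zero_iff, norm_smul, Real.norm_of_nonneg (inv_pos.2 (hr i)).le,
        inv_mul_le_iff₀ (hr i), ← dist_eq_norm]
      exact hx
    · rw [Set.indicator_of_notMem hx]
      exact (hχ01 _).1
  have h0 := ge_of_tendsto' ((tendsto_one_div_add_atTop_nhds_zero_nat (𝕜 := ℝ)).const_mul
    (∫ y, X y ∂ν)) hk
  rwa [mul_zero] at h0

theorem IsBallTest.neg {a : EuclideanSpace ℝ (Fin n)} {ρ : ℝ}
    {f : EuclideanSpace ℝ (Fin n) → ℝ} (hf : IsBallTest a ρ f) :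
    IsBallTest a ρ (fun x => -f x) :=
  ⟨hf.1.neg, fun x => by rw [abs_neg]; exact hf.2.1 x, fun x hx => neg_eq_zero.2 (hf.2.2 x hx)⟩

theorem partialDeriv_const_mul {φ : EuclideanSpace ℝ (Fin n) → ℝ} (hφ : Differentiable ℝ φ)
    (κ : ℝ) (j : Fin n) (x : EuclideanSpace ℝ (Fin n)) :
    partialDeriv (fun y => κ * φ y) j x = κ * partialDeriv φ j x := by
  rw [partialDeriv, fderiv_const_mul (hφ x)]
  rfl

theorem partialDeriv_neg (φ : EuclideanSpace ℝ (Fin n) → ℝ)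
    (j : Fin n) (x : EuclideanSpace ℝ (Fin n)) :
    partialDeriv (fun y => -φ y) j x = -partialDeriv φ j x := by
  rw [partialDeriv, fderiv_fun_neg]
  rfl

/-- By linearity the one-sided bound applies to small multiples of both φ and −φ. -/
theorem integral_partialDeriv_eq_zero_of_isTangentMeasure [IsLocallyFiniteMeasure μ]
    {a : EuclideanSpace ℝ (Fin n)} {v : Fin n → ℝ}
    (hv : ∀ k : ℕ, ∃ ρ₀ > 0, ∀ ρ ∈ Set.Ioo 0 ρ₀, ∀ f : EuclideanSpace ℝ (Fin n) → ℝ,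
      ContDiff ℝ 1 f → IsBallTest a ρ f →
      ∫ x, ∑ j, partialDeriv f j x * v j ∂μ ≤
        1 / ((k : ℝ) + 1) * μ.real (Metric.closedBall a ρ))
    {ν : Measure (EuclideanSpace ℝ (Fin n))} (hν : IsTangentMeasure μ a ν)
    {φ : EuclideanSpace ℝ (Fin n) → ℝ} (hφ : ContDiff ℝ 1 φ) (hφc : HasCompactSupport φ) :
    ∫ y, ∑ j, partialDeriv φ j y * v j ∂ν = 0 := by
  obtain ⟨K, hK⟩ := hφ.lipschitzWith_of_hasCompactSupport hφc one_ne_zero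
  obtain ⟨C, hC⟩ := hφ.continuous.bounded_above_of_compact_support hφc
  obtain ⟨R₀, hR₀⟩ := hφc.isBounded.subset_closedBall (0 : EuclideanSpace ℝ (Fin n))
  have hC0 : 0 ≤ C := (norm_nonneg _).trans (hC 0)
  -- Scaling by κ brings the Lipschitz constant and the sup norm below 1, and the radius is taken at
  -- least 1.
  let κ : ℝ := (K + C + 1)⁻¹
  have hden : (0 : ℝ) < K + C + 1 := by positivity
  have hκ : 0 < κ := inv_pos.2 hden
  have hR : (0 : ℝ) < max R₀ 1 := lt_max_of_lt_right one_pos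
  have htest : IsBallTest 0 (max R₀ 1) (fun y => κ * φ y) := by
    refine ⟨LipschitzWith.of_dist_le_mul fun x y => ?_, fun x => ?_, fun x hx => ?_⟩
    · have h := hK.dist_le_mul x y
      rw [Real.dist_eq] at h ⊢
      rw [← mul_sub, abs_mul, abs_of_pos hκ, inv_mul_le_iff₀ hden]
      have := K.2
      push_cast
      nlinarith [dist_nonneg (x := x) (y := y)]
    · refine le_trans ?_ (le_max_right _ _)
      rw [abs_mul, abs_of_pos hκ, inv_mul_le_iff₀ hden]
      have h := hC x
      rw [Real.norm_eq_abs] at h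
      have := K.2
      linarith
    · exact mul_eq_zero_of_right _ (image_eq_zero_of_notMem_tsupport fun h => hx
        (Metric.closedBall_subset_closedBall (le_max_left _ _) (hR₀ h)))
  have hd := hφ.differentiable one_ne_zero
  have hκd : ContDiff ℝ 1 (fun y => κ * φ y) := contDiff_const.mul hφ
  have h1 := integral_partialDeriv_le_zero_of_isTangentMeasure hv hν hκd hR htest
  have h2 := integral_partialDeriv_le_zero_of_isTangentMeasure hv hν hκd.neg hR htest.neg
  simp only [partialDeriv_neg, partialDeriv_const_mul hd, neg_mul, Finset.sum_neg_distrib,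
    mul_assoc, ← Finset.mul_sum, integral_neg, integral_const_mul] at h1 h2
  have h3 : κ * ∫ y, ∑ j, partialDeriv φ j y * v j ∂ν = 0 := le_antisymm h1 (by linarith)
  exact (mul_eq_zero.1 h3).resolve_left hκ.ne'

/-! ### Vanishing derivatives imply translation invariance. -/

/-- A locally finite measure all of whose distributional partial derivatives vanish is translation
invariant. -/
theorem isAddLeftInvariant_of_integral_partialDeriv_eq_zero
    {ν : Measure (EuclideanSpace ℝ (Fin n))} [IsLocallyFiniteMeasure ν]
    (h : ∀ φ : EuclideanSpace ℝ (Fin n) → ℝ, ContDiff ℝ 1 φ → HasCompactSupport φ →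
      ∀ j, ∫ y, partialDeriv φ j y ∂ν = 0) : ν.IsAddLeftInvariant := by
  have hsmooth : ∀ φ : EuclideanSpace ℝ (Fin n) → ℝ, ContDiff ℝ 1 φ → HasCompactSupport φ →
      ∀ w, ∫ y, φ (w + y) ∂ν = ∫ y, φ y ∂ν := by
    intro φ hφ hφc w
    have hderiv : ∀ t : ℝ, HasDerivAt (fun t : ℝ => ∫ y, φ (t • w + y) ∂ν) 0 t := by
      intro t₀
      obtain ⟨K, hK⟩ := hφ.lipschitzWith_of_hasCompactSupport hφc one_ne_zero
      obtain ⟨R, hR⟩ := hφc.isBounded.subset_closedBall (0 : EuclideanSpace ℝ (Fin n))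
      -- S contains the supports of all translates φ(t • w + ·) with |t − t₀| < 1, so one integrable
      -- function dominates their derivatives.
      let S := Metric.closedBall (0 : EuclideanSpace ℝ (Fin n)) (R + (|t₀| + 1) * ‖w‖)
      have hshift : ∀ t : ℝ, HasCompactSupport fun y => φ (t • w + y) := fun t =>
        hφc.comp_homeomorph (Homeomorph.addLeft (t • w))
      have hshiftd : ∀ t : ℝ, ContDiff ℝ 1 fun y => φ (t • w + y) := fun t => by fun_prop
      have hfd : ∀ (t : ℝ) y, fderiv ℝ (fun y => φ (t • w + y)) y = fderiv ℝ φ (t • w + y) :=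
        fun t y => fderiv_comp_add_left (𝕜 := ℝ) (f := φ) (t • w)
      have hmain := hasDerivAt_integral_of_dominated_loc_of_deriv_le (μ := ν)
        (F := fun t y => φ (t • w + y)) (x₀ := t₀)
        (F' := fun t y => fderiv ℝ φ (t • w + y) w)
        (bound := S.indicator fun _ => K * ‖w‖)
        (Metric.ball_mem_nhds t₀ one_pos)
        (Eventually.of_forall fun t => (hshiftd t).continuous.aestronglyMeasurable)
        ((hshiftd t₀).continuous.integrable_of_hasCompactSupport (hshift t₀))
        (((hφ.continuous_fderiv one_ne_zero).comp (continuous_const.add continuous_id)).clm_apply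
          continuous_const).aestronglyMeasurable
        (Eventually.of_forall fun y t ht => by
          by_cases hy : y ∈ S
          · rw [Set.indicator_of_mem hy]
            exact (fderiv ℝ φ _).le_of_opNorm_le (norm_fderiv_le_of_lipschitz ℝ hK) w
          · rw [Set.indicator_of_notMem hy]
            have hnot : t • w + y ∉ tsupport φ := fun hmem => hy (by
              have h1 := mem_closedBall_zero_iff.1 (hR hmem)
              have h2 : ‖y‖ ≤ ‖t • w + y‖ + ‖t • w‖ := by
                simpa using norm_sub_le (t • w + y) (t • w)
              have h3 : |t| ≤ |t₀| + 1 := by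
                have := Metric.mem_ball.1 ht
                rw [Real.dist_eq] at this
                have := abs_sub_abs_le_abs_sub t t₀
                linarith
              rw [mem_closedBall_zero_iff]
              rw [norm_smul, Real.norm_eq_abs] at h2
              have := mul_le_mul_of_nonneg_right h3 (norm_nonneg w)
              linarith)
            have h0 := image_eq_zero_of_notMem_tsupport
              fun hmem => hnot (tsupport_fderiv_subset ℝ hmem)
            rw [h0]
            simp)
        ((integrable_indicator_iff measurableSet_closedBall).2
          (integrableOn_const measure_closedBall_lt_top.ne))
        (Eventually.of_forall fun y t _ => by
          have h1 : HasDerivAt (fun t : ℝ => t • w + y) w t := by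
            simpa using ((hasDerivAt_id t).smul_const w).add_const y
          exact ((hφ.differentiable one_ne_zero _).hasFDerivAt).comp_hasDerivAt t h1)
      -- The derivative in t is ∑ⱼ wⱼ times the integral of the j-th partial derivative of a
      -- translate of φ, to which the hypothesis applies.
      have hval : ∫ y, fderiv ℝ φ (t₀ • w + y) w ∂ν = 0 := by
        simp only [← hfd, fderiv_apply_eq_sum]
        rw [integral_finsetSum]
        · refine Finset.sum_eq_zero fun j _ => ?_
          rw [integral_mul_const, h _ (hshiftd t₀) (hshift t₀) j, zero_mul]
        · exact fun j _ => ((continuous_partialDeriv (hshiftd t₀)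
            j).integrable_of_hasCompactSupport ((hshift t₀).fderiv_apply ℝ _)).mul_const _
      have h4 := hmain.2
      rwa [hval] at h4
    have hconst := is_const_of_deriv_eq_zero (fun t => (hderiv t).differentiableAt)
      (fun t => (hderiv t).deriv) 1 0
    simpa using hconst
  refine ⟨fun w => ?_⟩
  have : (ν.map (w + ·)).Regular :=
    Measure.Regular.map (Homeomorph.addLeft w)
  refine Measure.ext_of_integral_eq_on_compactlySupported fun f => ?_
  have hf : Continuous (fun y => f y) := map_continuous f
  rw [integral_map (by fun_prop) hf.aestronglyMeasurable]
  have hfc : HasCompactSupport f := f.hasCompactSupport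
  have hfw : HasCompactSupport fun y => f (w + y) := hfc.comp_homeomorph (Homeomorph.addLeft w)
  have hbound : ∀ {q : EuclideanSpace ℝ (Fin n) → ℝ} {S : Set (EuclideanSpace ℝ (Fin n))} {ε : ℝ},
      IsCompact S → (∀ y, |q y| ≤ ε) → (∀ y ∉ S, q y = 0) → |∫ y, q y ∂ν| ≤ ε * ν.real S := by
    intro q S ε hS hq hq0
    rw [← setIntegral_eq_integral_of_forall_compl_eq_zero hq0]
    exact norm_setIntegral_le_of_norm_le_const (f := q) hS.measure_lt_top fun y _ => hq y
  -- C¹ functions approximate f uniformly with support inside that of f, so the error is controlled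
  -- by the finite measure of two fixed compact sets.
  have hest : ∀ k : ℕ, |∫ y, f (w + y) ∂ν - ∫ y, f y ∂ν| ≤
      (ν.real (tsupport fun y => f (w + y)) + ν.real (tsupport f)) * (1 / ((k : ℝ) + 1)) := by
    intro k
    obtain ⟨g, hg, hgf, hgs⟩ := hf.exists_contDiff_approx 1
      (ε := fun _ => 1 / ((k : ℝ) + 1)) continuous_const (fun _ => Nat.one_div_pos_of_nat)
    have hgc : HasCompactSupport g := hfc.mono hgs
    have hg0 : ∀ y, f y = 0 → g y = 0 := fun y hy => by
      by_contra hne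
      exact hgs hne hy
    have h1 : |∫ y, (f (w + y) - g (w + y)) ∂ν| ≤
        1 / ((k : ℝ) + 1) * ν.real (tsupport fun y => f (w + y)) := by
      refine hbound hfw (fun y => ?_) fun y hy => ?_
      · rw [abs_sub_comm]
        exact (hgf (w + y)).le
      · have h0 : f (w + y) = 0 :=
          image_eq_zero_of_notMem_tsupport (f := fun y => f (w + y)) hy
        rw [h0, hg0 _ h0, sub_zero]
    have h2 : |∫ y, (f y - g y) ∂ν| ≤ 1 / ((k : ℝ) + 1) * ν.real (tsupport f) := by
      refine hbound hfc (fun y => ?_) fun y hy => ?_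
      · rw [abs_sub_comm]
        exact (hgf y).le
      · have h0 : f y = 0 := image_eq_zero_of_notMem_tsupport hy
        rw [h0, hg0 _ h0, sub_zero]
    have hgw : HasCompactSupport fun y => g (w + y) :=
      hgc.comp_homeomorph (Homeomorph.addLeft w)
    have hfi : Integrable (fun y => f (w + y)) ν :=
      (hf.comp (continuous_const.add continuous_id)).integrable_of_hasCompactSupport hfw
    have hgi : Integrable (fun y => g (w + y)) ν :=
      (hg.continuous.comp (continuous_const.add continuous_id)).integrable_of_hasCompactSupport hgw
    rw [integral_sub hfi hgi, hsmooth g hg hgc w] at h1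
    rw [integral_sub (hf.integrable_of_hasCompactSupport hfc)
      (hg.continuous.integrable_of_hasCompactSupport hgc)] at h2
    rw [abs_le] at h1 h2 ⊢
    constructor <;> linarith
  have h0 := ge_of_tendsto' ((tendsto_one_div_add_atTop_nhds_zero_nat (𝕜 := ℝ)).const_mul
    (ν.real (tsupport fun y => f (w + y)) + ν.real (tsupport f))) hest
  rw [mul_zero] at h0
  exact sub_eq_zero.1 (abs_eq_zero.1 (le_antisymm h0 (abs_nonneg _)))

end Euclidean

end

/-! ### Conclusion. -/

theorem corollary3p12 (n : ℕ) (μ : Measure (EuclideanSpace ℝ (Fin n)))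
    [IsLocallyFiniteMeasure μ] (hμ : derivationRank μ = n) :
    ∀ᵐ a ∂μ, ∀ ν : Measure (EuclideanSpace ℝ (Fin n)),
      IsTangentMeasure μ a ν → derivationRank ν = n := by
  obtain ⟨s, hs, hli⟩ := exists_finset_linearIndependent_of_le_rank (R := Linfty μ)
    (M := DerivationModule μ) (n := n) hμ.ge
  let e : Fin n ≃ s := (Finset.equivFinOfCardEq hs).symm
  let δ : Fin n → DerivationModule μ := fun i => e i
  have hδ : LinearIndependent (Linfty μ) δ :=
    LinearIndependent.comp (v := fun x : s => (x : DerivationModule μ)) hli e e.injective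
  have h1 : ∀ᵐ a ∂μ, ∀ i, ∀ k : ℕ, ∃ ρ₀ > 0, ∀ ρ ∈ Set.Ioo 0 ρ₀,
      ∀ f : EuclideanSpace ℝ (Fin n) → ℝ, ContDiff ℝ 1 f → IsBallTest a ρ f →
      ∫ x, ∑ j, partialDeriv f j x * derivationComponent (δ i).1 j a ∂μ ≤
        1 / ((k : ℝ) + 1) * μ.real (Metric.closedBall a ρ) :=
    ae_all_iff.2 fun i => ae_all_iff.2 fun k =>
      IsMetricDerivation.ae_eventually_integral_partialDeriv_le (δ i).2 Nat.one_div_pos_of_nat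
  filter_upwards [h1, ae_eq_zero_of_sum_derivationComponent_eq_zero hδ] with a ha1 ha2 ν hν
  have : IsLocallyFiniteMeasure ν := hν.1
  have : NeZero ν := ⟨hν.2.1⟩
  have : ν.IsAddLeftInvariant := by
    -- The vector of integrals ∫ ∂ⱼφ dν is orthogonal to the n frozen vectors at a, which span ℝⁿ,
    -- so it is zero.
    refine isAddLeftInvariant_of_integral_partialDeriv_eq_zero fun φ hφ hφc => congrFun
      (ha2 (fun j => ∫ y, partialDeriv φ j y ∂ν) fun i => ?_)
    rw [← integral_partialDeriv_eq_zero_of_isTangentMeasure (ha1 i) hν hφ hφc, integral_finsetSum]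
    · exact Finset.sum_congr rfl fun j _ => by rw [integral_mul_const, mul_comm]
    · exact fun j _ => ((continuous_partialDeriv hφ j).integrable_of_hasCompactSupport
        (hφc.fderiv_apply ℝ _)).mul_const _
  -- Local finiteness gives finiteness on compact sets; invariance and ν ≠ 0 give positivity on
  -- nonempty open sets.
  have : ν.IsAddHaarMeasure := { }
  exact le_antisymm (derivationRank_le hν.2.1) le_derivationRank_of_isAddHaarMeasure
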